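/- \textbf{Setting.} A \emph{generalised probabilistic theory} (GPT) is a symmetric monoidal process theory. For all systems $A,B$ the processes $A\to B$ form a closed convex cone $K_A^B$ in a finite-dimensional real vector space $V_A^B$ spanned by it. Sequential and parallel composition are bilinear. States of $A$ form $K^A$ (processes from the trivial system), effects on $A$ form $K_A$ (processes to the trivial system), and numbers (processes from the trivial system to itself) are the nonnegative reals. Two processes $f,g:A\to B$ that yield the same number for all systems $C$, all states of $AC$ and all effects on $BC$ are equal. Each system $A$ has a discarding effect $d_A$, with $d_{AB}=d_A\otimes d_B$ and $d_I=1$ for the trivial system $I$. Write $f\le g$ if $g=f+z$ for some process $z$. A process $f:A\to B$ is \emph{causal} if $d_B\circ f=d_A$ and \emph{subcausal} if $d_B\circ f\le d_A$. Every system has a causal state, and every process is subcausal up to a positive factor. (Given the rest, these two conditions say exactly that every $K_A^B$ has a causal process in its interior.) The GPT is \emph{non-classical} if for some system $A$ the set of causal states is not a simplex. It satisfies the \emph{No-Restriction Hypothesis} if for every $A$ the cone $K_A$ is the whole dual cone of $K^A$, and \emph{Tomographic Locality} if every state of a composite $AB$ is determined by the numbers it gives on product effects $e\otimes f$, with $e\in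 K_A$ and $f\in K_B$. A \emph{bank strategy} on $A$ is a finite family $\mathcal S_A=\{(p_i,s_i,e_i)\}$ with $p_i>0$, $\sum_i p_i=1$, causal states $s_i$ of $A$, and effects $e_i\le d_A$ with $e_i(s_i)=1$. Its counterfeiting value is $$\alpha_A=\sup\Big\{\sum_i p_i\,(e_i\otimes e_i)\big(\chi(s_i)\big)\ :\ \chi\in K_A^{AA}\text{ subcausal}\Big\}.$$ It satisfies \emph{Verification Sharpness} (VS) if for every $i$ and every subcausal state $s$ of $A$ one has $e_i(s)=1\iff s=s_i$. Its ensemble is \emph{classical} if all $s_i$ lie in the convex hull of finitely many causal states $t_1,\dots,t_m$ for which there are effects $f_1,\dots,f_m$ with $\sum_k f_k=d_A$ and $f_k(t_j)=\delta_{jk}$. For $n\ge1$ let $\mathcal S_A^{\otimes n}$ be the bank strategy on $A^{\otimes n}$ formed by $n$ independent copies of $\mathcal S_A$, and $\alpha_{A^{\otimes n}}$ its counterfeiting value. The GPT satisfies \emph{Strong No-Counterfeiting} (SNC) if for every $\delta>0$ there is a bank strategy on some system with counterfeiting value at most $\delta$. \textbf{Statement.} Let a non-classical GPT satisfy the No-Restriction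 Hypothesis and Tomographic Locality, and let $\mathcal S_A$ be a bank strategy in it that satisfies VS. Then the GPT satisfies SNC. Moreover, if the ensemble of $\mathcal S_A$ is not classical, then $\alpha_A<1$ and $\alpha_{A^{\otimes n}}\le\alpha_A^{\,n}$ for all $n\ge1$, so that repetitions of $\mathcal S_A$ itself give unforgeable money. -/

import Mathlib

open CategoryTheory MonoidalCategory

universe v u

/-- A generalised probabilistic theory, presented through the real vector spaces spanned by its
cones of processes. The objects of the symmetric monoidal category `C` are the systems, and
`𝟙_ C` is the trivial system. The hom-space `A ⟶ B` is the real vector space `V_A^B`, and the cone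
`cone A B ⊆ V_A^B` is the set `K_A^B` of (physical) processes from `A` to `B`, by which `V_A^B` is
spanned. Sequential and parallel composition are the bilinear operations of `C`. States of `A` are
the elements of `cone (𝟙_ C) A`, effects on `A` are the elements of `cone A (𝟙_ C)`. -/
structure GPT (C : Type u) [Category.{v} C] [Preadditive C] [Linear ℝ C] [MonoidalCategory C]
    [MonoidalPreadditive C] [MonoidalLinear ℝ C] [SymmetricCategory C] where
  /-- The cone `K_A^B` of processes from `A` to `B`. -/
  cone : ∀ A B : C, PointedCone ℝ (A ⟶ B)
  /-- Processes are closed under being wired together. -/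
  id_mem : ∀ A : C, 𝟙 A ∈ cone A A
  comp_mem : ∀ {A B D : C} (f : A ⟶ B) (g : B ⟶ D),
    f ∈ cone A B → g ∈ cone B D → f ≫ g ∈ cone A D
  tensor_mem : ∀ {A B A' B' : C} (f : A ⟶ B) (g : A' ⟶ B'),
    f ∈ cone A B → g ∈ cone A' B' → (f ⊗ₘ g) ∈ cone (A ⊗ A') (B ⊗ B')
  associator_hom_mem : ∀ A B D : C, (α_ A B D).hom ∈ cone ((A ⊗ B) ⊗ D) (A ⊗ (B ⊗ D))
  associator_inv_mem : ∀ A B D : C, (α_ A B D).inv ∈ cone (A ⊗ (B ⊗ D)) ((A ⊗ B) ⊗ D)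
  leftUnitor_hom_mem : ∀ A : C, (λ_ A).hom ∈ cone (𝟙_ C ⊗ A) A
  leftUnitor_inv_mem : ∀ A : C, (λ_ A).inv ∈ cone A (𝟙_ C ⊗ A)
  rightUnitor_hom_mem : ∀ A : C, (ρ_ A).hom ∈ cone (A ⊗ 𝟙_ C) A
  rightUnitor_inv_mem : ∀ A : C, (ρ_ A).inv ∈ cone A (A ⊗ 𝟙_ C)
  braiding_mem : ∀ A B : C, (β_ A B).hom ∈ cone (A ⊗ B) (B ⊗ A)
  /-- The vector space `V_A^B` is spanned by the processes, it is finite-dimensional, and the cone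
  of processes is closed in it (for the canonical topology of a finite-dimensional space). -/
  span_cone : ∀ A B : C, Submodule.span ℝ (cone A B : Set (A ⟶ B)) = ⊤
  finite : ∀ A B : C, Module.Finite ℝ (A ⟶ B)
  isClosed_cone : ∀ A B : C, @IsClosed _ (moduleTopology ℝ (A ⟶ B)) (cone A B : Set (A ⟶ B))
  /-- Numbers, that is processes from the trivial system to itself, are the nonnegative reals. -/
  num : (𝟙_ C ⟶ 𝟙_ C) ≃ₗ[ℝ] ℝ
  num_id : num (𝟙 (𝟙_ C)) = 1
  mem_cone_unit : ∀ x : 𝟙_ C ⟶ 𝟙_ C, x ∈ cone (𝟙_ C) (𝟙_ C) ↔ 0 ≤ num x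
  /-- Tomography: processes that give the same numbers in all situations are equal. -/
  tomography : ∀ {A B : C} (f g : A ⟶ B), f ∈ cone A B → g ∈ cone A B →
    (∀ (D : C) (s : 𝟙_ C ⟶ A ⊗ D) (e : B ⊗ D ⟶ 𝟙_ C),
      s ∈ cone (𝟙_ C) (A ⊗ D) → e ∈ cone (B ⊗ D) (𝟙_ C) →
      num (s ≫ (f ▷ D) ≫ e) = num (s ≫ (g ▷ D) ≫ e)) → f = g
  /-- The discarding effects. -/
  discard : ∀ A : C, A ⟶ 𝟙_ C
  discard_mem : ∀ A : C, discard A ∈ cone A (𝟙_ C)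
  discard_unit : discard (𝟙_ C) = 𝟙 (𝟙_ C)
  discard_tensor : ∀ A B : C,
    discard (A ⊗ B) = (discard A ⊗ₘ discard B) ≫ (λ_ (𝟙_ C)).hom
  /-- Every system has a causal state. -/
  exists_causal_state : ∀ A : C, ∃ s ∈ cone (𝟙_ C) A, s ≫ discard A = 𝟙 (𝟙_ C)
  /-- Every process is subcausal up to a positive factor. -/
  exists_subcausal_smul : ∀ {A B : C} (f : A ⟶ B), f ∈ cone A B →
    ∃ r : ℝ, 0 < r ∧ discard A - (r • f) ≫ discard B ∈ cone A (𝟙_ C)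

namespace GPT

section Tensor

variable {C : Type u} [Category.{v} C] [MonoidalCategory C] {A B : C}

/-- The parallel composite of two states, as a state of the composite system. -/
def tensorState (s : 𝟙_ C ⟶ A) (t : 𝟙_ C ⟶ B) : 𝟙_ C ⟶ A ⊗ B :=
  (λ_ (𝟙_ C)).inv ≫ (s ⊗ₘ t)

/-- The parallel composite of two effects, as an effect on the composite system. -/
def tensorEffect (e : A ⟶ 𝟙_ C) (f : B ⟶ 𝟙_ C) : A ⊗ B ⟶ 𝟙_ C :=
  (e ⊗ₘ f) ≫ (λ_ (𝟙_ C)).hom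

lemma tensorState_comp_tensorEffect (s : 𝟙_ C ⟶ A) (t : 𝟙_ C ⟶ B) (e : A ⟶ 𝟙_ C)
    (f : B ⟶ 𝟙_ C) : tensorState s t ≫ tensorEffect e f = (t ≫ f) ≫ (s ≫ e) := by
  simp only [tensorState, tensorEffect, Category.assoc]
  rw [← Category.assoc (s ⊗ₘ t), tensorHom_comp_tensorHom, tensorHom_def',
    Category.assoc, unitors_equal, rightUnitor_naturality, ← unitors_equal,
    leftUnitor_naturality_assoc, Iso.inv_hom_id_assoc, Category.assoc]

end Tensor

variable {C : Type u} [Category.{v} C] [Preadditive C] [Linear ℝ C] [MonoidalCategory C]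
  [MonoidalPreadditive C] [MonoidalLinear ℝ C] [SymmetricCategory C] (T : GPT C)

/-- The order of processes: `f ≤ g` if `f + z = g` for some process `z`. -/
def Le {A B : C} (f g : A ⟶ B) : Prop :=
  ∃ z ∈ T.cone A B, f + z = g

/-- Causal processes: discarding the output amounts to discarding the input. -/
def IsCausal {A B : C} (f : A ⟶ B) : Prop :=
  f ∈ T.cone A B ∧ f ≫ T.discard B = T.discard A

/-- Subcausal processes. -/
def IsSubcausal {A B : C} (f : A ⟶ B) : Prop :=
  f ∈ T.cone A B ∧ T.Le (f ≫ T.discard B) (T.discard A)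

/-- The convex set of causal states of a system. -/
def causalStates (A : C) : Set (𝟙_ C ⟶ A) :=
  {s | T.IsCausal s}

/-- A system is classical if its causal states form a simplex. -/
def IsClassicalSystem (A : C) : Prop :=
  ∃ (n : ℕ) (t : Fin n → (𝟙_ C ⟶ A)),
    AffineIndependent ℝ t ∧ T.causalStates A = convexHull ℝ (Set.range t)

/-- A theory is non-classical if some system is not classical. -/
def NonClassical : Prop :=
  ∃ A : C, ¬ T.IsClassicalSystem A

/-- The No-Restriction Hypothesis: the cone of effects on `A` is the whole dual of the cone of
states of `A`. -/
def NoRestriction : Prop :=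
  ∀ (A : C) (φ : (𝟙_ C ⟶ A) →ₗ[ℝ] ℝ), (∀ s ∈ T.cone (𝟙_ C) A, 0 ≤ φ s) →
    ∃ e ∈ T.cone A (𝟙_ C), ∀ s : 𝟙_ C ⟶ A, T.num (s ≫ e) = φ s

/-- Tomographic Locality: a state of a composite system is determined by the numbers that local
effects give on it. -/
def TomographicLocality : Prop :=
  ∀ (A B : C), ∀ s ∈ T.cone (𝟙_ C) (A ⊗ B), ∀ t ∈ T.cone (𝟙_ C) (A ⊗ B),
    (∀ e ∈ T.cone A (𝟙_ C), ∀ f ∈ T.cone B (𝟙_ C),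
      T.num (s ≫ tensorEffect e f) = T.num (t ≫ tensorEffect e f)) → s = t

/-- A bank strategy on the system `A`: with probability `p i` the bank prepares the causal state
`s i`, which it verifies by the subcausal effect `e i`, which accepts `s i` with certainty. -/
structure BankStrategy (A : C) where
  ι : Type
  [fintype : Fintype ι]
  p : ι → ℝ
  s : ι → (𝟙_ C ⟶ A)
  e : ι → (A ⟶ 𝟙_ C)
  p_pos : ∀ i, 0 < p i
  p_sum : ∑ i, p i = 1
  s_causal : ∀ i, T.IsCausal (s i)
  e_mem : ∀ i, e i ∈ T.cone A (𝟙_ C)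
  e_le : ∀ i, T.Le (e i) (T.discard A)
  accept : ∀ i, T.num (s i ≫ e i) = 1

attribute [instance] BankStrategy.fintype

/-- The physical counterfeiting machines: subcausal processes from `A` to `A ⊗ A`. -/
def counterfeiters (A : C) : Set (A ⟶ A ⊗ A) :=
  {χ | T.IsSubcausal χ}

/-- The probability that both outputs of the
counterfeiting machine `χ` pass the verification. -/
def BankStrategy.successProb {T : GPT C} {A : C} (S : T.BankStrategy A) (χ : A ⟶ A ⊗ A) : ℝ :=
  ∑ i, S.p i * T.num (S.s i ≫ χ ≫ tensorEffect (S.e i) (S.e i))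

/-- The optimal counterfeiting probability `α_A` of a bank strategy. -/
noncomputable def BankStrategy.alpha {T : GPT C} {A : C} (S : T.BankStrategy A) : ℝ :=
  sSup (S.successProb '' T.counterfeiters A)

/-- Verification Sharpness: among the subcausal states, `e i` accepts with certainty exactly the
state `s i`. -/
def BankStrategy.VerificationSharp {T : GPT C} {A : C} (S : T.BankStrategy A) : Prop :=
  ∀ i, ∀ s : 𝟙_ C ⟶ A, T.IsSubcausal s → (T.num (s ≫ S.e i) = 1 ↔ s = S.s i)

/-- The ensemble of a bank strategy is classical if its states lie in a simplex whose vertices are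
causal states that a single measurement distinguishes perfectly. -/
def BankStrategy.ClassicalEnsemble {T : GPT C} {A : C} (S : T.BankStrategy A) : Prop :=
  ∃ (n : ℕ) (t : Fin n → (𝟙_ C ⟶ A)) (f : Fin n → (A ⟶ 𝟙_ C)),
    (∀ j, T.IsCausal (t j)) ∧ (∀ j, f j ∈ T.cone A (𝟙_ C)) ∧ ∑ j, f j = T.discard A ∧
    (∀ j k, T.num (t j ≫ f k) = if j = k then 1 else 0) ∧
    ∀ i, S.s i ∈ convexHull ℝ (Set.range t)

/-- Strong No-Counterfeiting: unforgeable money exists. -/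
def SNC : Prop :=
  ∀ δ : ℝ, 0 < δ → ∃ (A : C) (S : T.BankStrategy A), S.alpha ≤ δ

section Product

variable {A B : C}

lemma eq_num_smul (x : 𝟙_ C ⟶ 𝟙_ C) : x = T.num x • 𝟙 (𝟙_ C) := by
  apply T.num.injective
  rw [map_smul, T.num_id, smul_eq_mul, mul_one]

lemma num_comp (x y : 𝟙_ C ⟶ 𝟙_ C) : T.num (x ≫ y) = T.num x * T.num y := by
  conv_lhs => rw [T.eq_num_smul x]
  rw [Linear.smul_comp, Category.id_comp, map_smul, smul_eq_mul]

lemma discard_tensor' (A B : C) :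
    T.discard (A ⊗ B) = tensorEffect (T.discard A) (T.discard B) :=
  T.discard_tensor A B

lemma tensorEffect_mem {e : A ⟶ 𝟙_ C} {f : B ⟶ 𝟙_ C} (he : e ∈ T.cone A (𝟙_ C))
    (hf : f ∈ T.cone B (𝟙_ C)) : tensorEffect e f ∈ T.cone (A ⊗ B) (𝟙_ C) :=
  T.comp_mem _ _ (T.tensor_mem _ _ he hf) (T.leftUnitor_hom_mem _)

lemma tensorState_isCausal {s : 𝟙_ C ⟶ A} {t : 𝟙_ C ⟶ B} (hs : T.IsCausal s)
    (ht : T.IsCausal t) : T.IsCausal (tensorState s t) := by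
  refine ⟨T.comp_mem _ _ (T.leftUnitor_inv_mem _) (T.tensor_mem _ _ hs.1 ht.1), ?_⟩
  rw [T.discard_tensor', tensorState_comp_tensorEffect, hs.2, ht.2, T.discard_unit,
    Category.comp_id]

lemma tensorEffect_le {e : A ⟶ 𝟙_ C} {f : B ⟶ 𝟙_ C} (he : e ∈ T.cone A (𝟙_ C))
    (he' : T.Le e (T.discard A)) (hf' : T.Le f (T.discard B)) :
    T.Le (tensorEffect e f) (T.discard (A ⊗ B)) := by
  obtain ⟨z, hz, hez⟩ := he'
  obtain ⟨w, hw, hfw⟩ := hf'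
  refine ⟨tensorEffect e w + tensorEffect z (T.discard B),
    add_mem (T.tensorEffect_mem he hw) (T.tensorEffect_mem hz (T.discard_mem B)), ?_⟩
  rw [T.discard_tensor', ← hez, ← hfw]
  simp only [tensorEffect, MonoidalPreadditive.tensor_add, MonoidalPreadditive.add_tensor,
    Preadditive.add_comp]
  abel

/-- The product of two bank strategies: the bank samples independently from both. -/
def BankStrategy.prod {T : GPT C} (S : T.BankStrategy A) (S' : T.BankStrategy B) :
    T.BankStrategy (A ⊗ B) where
  ι := S.ι × S'.ι
  p := fun i => S.p i.1 * S'.p i.2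
  s := fun i => tensorState (S.s i.1) (S'.s i.2)
  e := fun i => tensorEffect (S.e i.1) (S'.e i.2)
  p_pos := fun i => mul_pos (S.p_pos i.1) (S'.p_pos i.2)
  p_sum := by rw [Fintype.sum_prod_type, ← Fintype.sum_mul_sum, S.p_sum, S'.p_sum, one_mul]
  s_causal := fun i => T.tensorState_isCausal (S.s_causal i.1) (S'.s_causal i.2)
  e_mem := fun i => T.tensorEffect_mem (S.e_mem i.1) (S'.e_mem i.2)
  e_le := fun i => T.tensorEffect_le (S.e_mem i.1) (S.e_le i.1) (S'.e_le i.2)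
  accept := fun i => by
    rw [tensorState_comp_tensorEffect, T.num_comp, S.accept, S'.accept, one_mul]

/-- The composite of `n + 1` copies of a system. -/
def tensorPow (A : C) : ℕ → C
  | 0 => A
  | n + 1 => tensorPow A n ⊗ A

/-- The bank strategy that puts `n + 1` independent copies of a strategy on each banknote. -/
def BankStrategy.copies {T : GPT C} (S : T.BankStrategy A) :
    (n : ℕ) → T.BankStrategy (tensorPow A n)
  | 0 => S
  | n + 1 => (S.copies n).prod S

end Product

end GPT

/-! Counterfeiting is a conic program, and both halves of the theorem rest on its optimum. The
optimum is attained, since subcausal processes form a compact set (`isCompact_subcausal`). Its dual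
is solved by a functional positive on effects, which under the No-Restriction Hypothesis is a state
(`exists_dual_state`). Dual states of two strategies tensor to a dual bound for their product, so
counterfeiting values are submultiplicative (`alpha_prod_le`).

If a sharp strategy has value 1, some machine passes every verification with certainty, and
sharpness makes it a cloner of all the `s i` (`clones_of_sharp`). Cloning amplifies imperfect
discrimination to perfect discrimination (`exists_separating_effect`), and copies let separate tests
be run as one measurement (`exists_measurement`). The ensemble is then classical, so a sharp
strategy without classical ensemble has value below 1.

For SNC it remains to find such a strategy on a non-classical system. Exposed causal states have
sharp verifications. If all uniform ensembles of them were classical, the exposed states would be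
linearly independent, hence finite in number, and would span the state space as a simplex
(`exists_sharp_not_classicalEnsemble`). -/

/-! ### Closed cones and compact convex sets in finite dimension -/

section FiniteDimensional

variable {V : Type*} [AddCommGroup V] [Module ℝ V]

lemma IsCompact.exists_linearMap_le {S : Set V} (hS : @IsCompact _ (moduleTopology ℝ V) S)
    (hne : S.Nonempty) (φ : V →ₗ[ℝ] ℝ) : ∃ x ∈ S, ∀ y ∈ S, φ y ≤ φ x := by
  let _ : TopologicalSpace V := moduleTopology ℝ V
  have : IsModuleTopology ℝ V := ⟨rfl⟩
  obtain ⟨x, hx, h⟩ := IsCompact.exists_isMaxOn hS hne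
    (IsModuleTopology.continuous_of_linearMap φ).continuousOn
  exact ⟨x, hx, h⟩

lemma IsCompact.inter_linearMap_eq {S : Set V} (hS : @IsCompact _ (moduleTopology ℝ V) S)
    (φ : V →ₗ[ℝ] ℝ) (c : ℝ) : @IsCompact _ (moduleTopology ℝ V) (S ∩ {x | φ x = c}) := by
  let _ : TopologicalSpace V := moduleTopology ℝ V
  have : IsModuleTopology ℝ V := ⟨rfl⟩
  exact IsCompact.inter_right hS
    (isClosed_eq (IsModuleTopology.continuous_of_linearMap φ) continuous_const)

variable [Module.Finite ℝ V]

/-- Euclidean coordinates on a finite-dimensional space that carries the module topology. -/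
noncomputable def euclideanCoords (V : Type*) [AddCommGroup V] [Module ℝ V] [Module.Finite ℝ V]
    [TopologicalSpace V] [IsModuleTopology ℝ V] :
    V ≃L[ℝ] EuclideanSpace ℝ (Fin (Module.finrank ℝ V)) :=
  haveI := IsModuleTopology.toContinuousAdd ℝ V
  haveI := IsModuleTopology.continuousNeg ℝ V
  haveI : IsTopologicalAddGroup V := {}
  let L : V ≃ₗ[ℝ] EuclideanSpace ℝ (Fin (Module.finrank ℝ V)) :=
    (Module.finBasis ℝ V).equivFun ≪≫ₗ (WithLp.linearEquiv 2 ℝ _).symm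
  { L with
    continuous_toFun := IsModuleTopology.continuous_of_linearMap L.toLinearMap
    continuous_invFun := L.symm.toLinearMap.continuous_of_finiteDimensional }

lemma PointedCone.exists_dual_neg_of_isClosed_moduleTopology (K : PointedCone ℝ V)
    (hK : @IsClosed _ (moduleTopology ℝ V) (K : Set V)) {x : V} (hx : x ∉ K) :
    ∃ φ : V →ₗ[ℝ] ℝ, (∀ y ∈ K, 0 ≤ φ y) ∧ φ x < 0 := by
  let _ : TopologicalSpace V := moduleTopology ℝ V
  have : IsModuleTopology ℝ V := ⟨rfl⟩
  let L := euclideanCoords V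
  let K' : ProperCone ℝ (EuclideanSpace ℝ (Fin (Module.finrank ℝ V))) :=
    { toSubmodule := K.map L.toLinearEquiv.toLinearMap
      isClosed' := by
        convert! hK.preimage L.symm.continuous using 1
        ext y
        constructor
        · rintro ⟨z, hz, rfl⟩
          simpa using hz
        · intro hy
          exact ⟨L.symm y, hy, by simp⟩ }
  have hx' : L x ∉ K' := by
    rintro ⟨z, hz, hzx⟩
    have : z = x := L.injective hzx
    exact hx (this ▸ hz)
  obtain ⟨f, hf, hfx⟩ := ProperCone.hyperplane_separation_point K' hx'
  exact ⟨f.toLinearMap ∘ₗ L.toLinearEquiv.toLinearMap, fun y hy => hf _ ⟨y, hy, rfl⟩, hfx⟩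

/-- An unbounded sequence in the set would, after normalisation, produce a unit vector `x` of `K`
with `-δ x ∈ K'`, which `h` forbids. -/
lemma isCompact_moduleTopology_of_recession {W : Type*} [AddCommGroup W] [Module ℝ W]
    (K : PointedCone ℝ V) (hK : @IsClosed _ (moduleTopology ℝ V) (K : Set V))
    (K' : PointedCone ℝ W) (hK' : @IsClosed _ (moduleTopology ℝ W) (K' : Set W))
    (δ : V →ₗ[ℝ] W) (d : W) (h : ∀ x ∈ K, -δ x ∈ K' → x = 0) :
    @IsCompact _ (moduleTopology ℝ V) {x | x ∈ K ∧ d - δ x ∈ K'} := by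
  let _ : TopologicalSpace V := moduleTopology ℝ V
  have : IsModuleTopology ℝ V := ⟨rfl⟩
  let _ : TopologicalSpace W := moduleTopology ℝ W
  have : IsModuleTopology ℝ W := ⟨rfl⟩
  have := IsModuleTopology.toContinuousAdd ℝ V
  have := IsModuleTopology.toContinuousAdd ℝ W
  have : ContinuousNeg W := IsModuleTopology.continuousNeg ℝ W
  have : IsTopologicalAddGroup W := {}
  let L := euclideanCoords V
  have hδ : Continuous fun x => δ (L.symm x) :=
    (IsModuleTopology.continuous_of_linearMap δ).comp L.symm.continuous
  have hS : {x | x ∈ K ∧ d - δ x ∈ K'} =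
      L.symm '' {x | L.symm x ∈ K ∧ d - δ (L.symm x) ∈ K'} := by
    ext x
    constructor
    · exact fun hx => ⟨L x, by simpa using hx, by simp⟩
    · rintro ⟨y, hy, rfl⟩
      exact hy
  rw [hS]
  refine IsCompact.image ?_ L.symm.continuous
  have hclosed : IsClosed {x | L.symm x ∈ K ∧ d - δ (L.symm x) ∈ K'} :=
    (hK.preimage L.symm.continuous).inter (hK'.preimage (continuous_const.sub hδ))
  refine Metric.isCompact_of_isClosed_isBounded hclosed ?_
  -- The constraint, homogenised by a scale `q.2` and cut down to unit vectors. By `h` the scale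
  -- never vanishes on this compact set, so it has a positive lower bound `c`; a point of norm above
  -- `1` and `c⁻¹` would rescale into `Q` with scale below `c`.
  let Q : Set (EuclideanSpace ℝ (Fin (Module.finrank ℝ V)) × ℝ) :=
    {q | L.symm q.1 ∈ K ∧ q.2 • d - δ (L.symm q.1) ∈ K'} ∩
      (Metric.sphere 0 1 ×ˢ Set.Icc 0 1)
  have hQ : IsCompact Q := by
    refine IsCompact.inter_left ((isCompact_sphere _ _).prod isCompact_Icc) ?_
    exact (hK.preimage (L.symm.continuous.comp continuous_fst)).inter
      (hK'.preimage ((continuous_snd.smul continuous_const).sub (hδ.comp continuous_fst)))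
  obtain ⟨c, hc, hcQ⟩ : ∃ c : ℝ, 0 < c ∧ ∀ q ∈ Q, c ≤ q.2 := by
    rcases Q.eq_empty_or_nonempty with hQe | hQn
    · exact ⟨1, one_pos, by simp [hQe]⟩
    · obtain ⟨q, hq, hmin⟩ := hQ.exists_isMinOn hQn continuous_snd.continuousOn
      refine ⟨q.2, lt_of_le_of_ne hq.2.2.1 ?_, fun r hr => hmin hr⟩
      intro h0
      have hm := hq.1.2
      rw [← h0, zero_smul, zero_sub] at hm
      have hz := h _ hq.1.1 hm
      have : q.1 = 0 := by simpa using hz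
      have h1 := hq.2.1
      rw [this] at h1
      simp at h1
  refine (Metric.isBounded_iff_subset_closedBall 0).2 ⟨max 1 c⁻¹, fun x hx => ?_⟩
  rw [mem_closedBall_zero_iff]
  by_contra! hlt
  have h1 : 1 < ‖x‖ := (le_max_left _ _).trans_lt hlt
  have h2 : c⁻¹ < ‖x‖ := (le_max_right _ _).trans_lt hlt
  have h0 : 0 < ‖x‖ := one_pos.trans h1
  have hmem : (‖x‖⁻¹ • x, ‖x‖⁻¹) ∈ Q := by
    refine ⟨⟨?_, ?_⟩, ?_, ?_⟩
    · simpa using K.smul_mem (inv_nonneg.2 (norm_nonneg x)) hx.1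
    · have := K'.smul_mem (inv_nonneg.2 (norm_nonneg x)) hx.2
      have h3 : ‖x‖⁻¹ • d - δ (L.symm (‖x‖⁻¹ • x)) = ‖x‖⁻¹ • (d - δ (L.symm x)) := by
        simp [smul_sub]
      change ‖x‖⁻¹ • d - δ (L.symm (‖x‖⁻¹ • x)) ∈ K'
      rw [h3]
      exact this
    · simp [norm_smul, h0.ne']
    · exact ⟨by positivity, inv_le_one_of_one_le₀ h1.le⟩
  have := hcQ _ hmem
  have h4 := (inv_lt_comm₀ hc h0).1 h2
  exact absurd this (not_le.2 h4)

/-- A finite set that contains all exposed points of a compact set has it in its convex hull. -/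
lemma IsCompact.subset_convexHull_of_exposed {S : Set V}
    (hS : @IsCompact _ (moduleTopology ℝ V) S) {F : Set V} (hF : F.Finite)
    (hexp : ∀ y ∈ S, (∃ φ : V →ₗ[ℝ] ℝ, ∀ t ∈ S, t ≠ y → φ t < φ y) → y ∈ F) :
    S ⊆ convexHull ℝ F := by
  let _ : TopologicalSpace V := moduleTopology ℝ V
  have : IsModuleTopology ℝ V := ⟨rfl⟩
  let L := euclideanCoords V
  intro x hx
  by_contra hxF
  have hxF' : L x ∉ convexHull ℝ (L '' F) := by
    have h := L.toLinearEquiv.toLinearMap.image_convexHull F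
    change L '' _ = convexHull ℝ (L '' F) at h
    rw [← h]
    rintro ⟨z, hz, hzx⟩
    have : z = x := L.injective hzx
    exact hxF (this ▸ hz)
  obtain ⟨f, u, hfu, hux⟩ := geometric_hahn_banach_closed_point (convex_convexHull ℝ _)
    ((hF.image L).isClosed_convexHull ℝ) hxF'
  obtain ⟨w, rfl⟩ := (InnerProductSpace.toDual ℝ _).surjective f
  simp only [InnerProductSpace.toDual_apply_apply] at hfu hux
  obtain ⟨B, hB⟩ : ∃ B : ℝ, ∀ y ∈ F, ‖L y - L x‖ ^ 2 ≤ B := by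
    obtain ⟨B, hB⟩ := (hF.image fun y => ‖L y - L x‖ ^ 2).bddAbove
    exact ⟨B, fun y hy => hB ⟨y, hy, rfl⟩⟩
  set ε := inner ℝ w (L x) - u with hε
  have hεpos : 0 < ε := by simp [hε, hux]
  obtain ⟨R, hR0, hR⟩ : ∃ R : ℝ, 0 ≤ R ∧ B < 2 * R * ε := by
    refine ⟨(|B| + 1) / ε, by positivity, ?_⟩
    rw [mul_assoc, div_mul_cancel₀ _ hεpos.ne']
    linarith [le_abs_self B, abs_nonneg B]
  -- The centre lies so far behind the separating hyperplane that every point of `F` is closer to it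
  -- than `x` is. The point of `S` farthest from `c` is exposed, hence in `F`, a contradiction.
  set c := L x - R • w with hc
  obtain ⟨y, hy, hmax⟩ := IsCompact.exists_isMaxOn hS ⟨x, hx⟩
    ((L.continuous.sub continuous_const).norm (f := fun z => L z - c)).continuousOn
  have hyF : y ∈ F := by
    -- `S` lies in the ball around `c` through `y`, and the outward normal exposes `y` in that ball.
    refine hexp y hy ⟨(innerSL ℝ (L y - c)).toLinearMap ∘ₗ L.toLinearEquiv.toLinearMap, ?_⟩
    intro t ht hty
    have h1 : ‖L t - c‖ ≤ ‖L y - c‖ := hmax ht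
    have h2 : 0 < ‖L t - L y‖ ^ 2 := by
      have : L t - L y ≠ 0 := sub_ne_zero.2 fun h => hty (L.injective h)
      positivity
    have h3 : ‖L t - c‖ ^ 2 ≤ ‖L y - c‖ ^ 2 := by gcongr
    have h4 : L t - L y = (L t - c) - (L y - c) := by abel
    rw [h4, norm_sub_sq_real] at h2
    have h5 : inner ℝ (L y - c) (L t - c) < inner ℝ (L y - c) (L y - c) := by
      rw [real_inner_self_eq_norm_sq, real_inner_comm]
      linarith
    rw [inner_sub_right, inner_sub_right _ (L y) c] at h5
    change inner ℝ (L y - c) (L t) < inner ℝ (L y - c) (L y)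
    linarith
  have h1 : ‖L x - c‖ ≤ ‖L y - c‖ := hmax hx
  have h2 : L x - c = R • w := by simp [hc]
  have h3 : L y - c = (L y - L x) + R • w := by simp only [hc]; abel
  have h4 : ‖L x - c‖ ^ 2 ≤ ‖L y - c‖ ^ 2 := by gcongr
  rw [h2, h3, norm_add_sq_real, inner_smul_right, inner_sub_left, real_inner_comm,
    real_inner_comm w (L x)] at h4
  have h5 := hfu (L y) (subset_convexHull ℝ _ ⟨y, hyF, rfl⟩)
  have h6 := hB y hyF
  have h7 : R * (inner ℝ w (L y) - inner ℝ w (L x)) ≤ R * (-ε) := by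
    gcongr
    simp only [hε]
    linarith
  linarith

end FiniteDimensional

/-! ### Partial contraction and insertion of effects and states -/

namespace GPT

section Contraction

variable {C : Type u} [Category.{v} C] [MonoidalCategory C] {A B X Y : C}

lemma whiskerLeft_comp_rightUnitor_comp (e : A ⟶ 𝟙_ C) (f : B ⟶ 𝟙_ C) :
    A ◁ f ≫ (ρ_ A).hom ≫ e = tensorEffect e f := by
  rw [tensorEffect, tensorHom_def', Category.assoc, unitors_equal, rightUnitor_naturality]

lemma whiskerRight_comp_leftUnitor_comp (e : A ⟶ 𝟙_ C) (f : B ⟶ 𝟙_ C) :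
    e ▷ B ≫ (λ_ B).hom ≫ f = tensorEffect e f := by
  rw [tensorEffect, MonoidalCategory.tensorHom_def, Category.assoc, leftUnitor_naturality]

lemma comp_rightUnitor_inv_comp_whiskerLeft (s : 𝟙_ C ⟶ A) (t : 𝟙_ C ⟶ B) :
    s ≫ (ρ_ A).inv ≫ A ◁ t = tensorState s t := by
  rw [tensorState, MonoidalCategory.tensorHom_def, unitors_inv_equal, rightUnitor_inv_naturality_assoc]

lemma comp_leftUnitor_inv_comp_whiskerRight (s : 𝟙_ C ⟶ A) (t : 𝟙_ C ⟶ B) :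
    t ≫ (λ_ B).inv ≫ s ▷ B = tensorState s t := by
  rw [tensorState, tensorHom_def', leftUnitor_inv_naturality_assoc]

/-- The effect `f` applied to the second factor of the output of a process. -/
def contractRight (χ : X ⟶ A ⊗ B) (f : B ⟶ 𝟙_ C) : X ⟶ A :=
  χ ≫ A ◁ f ≫ (ρ_ A).hom

/-- The effect `e` applied to the first factor of the output of a process. -/
def contractLeft (χ : X ⟶ A ⊗ B) (e : A ⟶ 𝟙_ C) : X ⟶ B :=
  χ ≫ e ▷ B ≫ (λ_ B).hom

/-- The state `t` inserted into the second factor of the input of a process. -/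
def insertRight (χ : A ⊗ B ⟶ X) (t : 𝟙_ C ⟶ B) : A ⟶ X :=
  (ρ_ A).inv ≫ A ◁ t ≫ χ

/-- The state `s` inserted into the first factor of the input of a process. -/
def insertLeft (χ : A ⊗ B ⟶ X) (s : 𝟙_ C ⟶ A) : B ⟶ X :=
  (λ_ B).inv ≫ s ▷ B ≫ χ

@[simp]
lemma contractRight_comp (χ : X ⟶ A ⊗ B) (f : B ⟶ 𝟙_ C) (e : A ⟶ 𝟙_ C) :
    contractRight χ f ≫ e = χ ≫ tensorEffect e f := by
  simp only [contractRight, Category.assoc, whiskerLeft_comp_rightUnitor_comp]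

@[simp]
lemma contractLeft_comp (χ : X ⟶ A ⊗ B) (e : A ⟶ 𝟙_ C) (f : B ⟶ 𝟙_ C) :
    contractLeft χ e ≫ f = χ ≫ tensorEffect e f := by
  simp only [contractLeft, Category.assoc, whiskerRight_comp_leftUnitor_comp]

lemma comp_insertRight_comp (χ : A ⊗ B ⟶ X) (t : 𝟙_ C ⟶ B) (s : 𝟙_ C ⟶ A) (f : X ⟶ Y) :
    s ≫ insertRight χ t ≫ f = tensorState s t ≫ χ ≫ f := by
  simp only [insertRight, Category.assoc, ← comp_rightUnitor_inv_comp_whiskerLeft]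

lemma comp_insertLeft_comp (χ : A ⊗ B ⟶ X) (s : 𝟙_ C ⟶ A) (t : 𝟙_ C ⟶ B) (f : X ⟶ Y) :
    t ≫ insertLeft χ s ≫ f = tensorState s t ≫ χ ≫ f := by
  simp only [insertLeft, Category.assoc, ← comp_leftUnitor_inv_comp_whiskerRight]

end Contraction

/-- Naturality pushes the interchange past the four effects onto copies of the trivial system, where
coherence absorbs it. It regroups two banknotes on `A ⊗ B` as a pair on `A` and a pair on `B`. -/
lemma tensorμ_comp_tensorEffect {C : Type u} [Category.{v} C] [MonoidalCategory C]
    [SymmetricCategory C] {X₁ X₂ Y₁ Y₂ : C} (e₁ : X₁ ⟶ 𝟙_ C) (e₂ : X₂ ⟶ 𝟙_ C)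
    (f₁ : Y₁ ⟶ 𝟙_ C) (f₂ : Y₂ ⟶ 𝟙_ C) :
    tensorμ X₁ X₂ Y₁ Y₂ ≫ tensorEffect (tensorEffect e₁ f₁) (tensorEffect e₂ f₂) =
      tensorEffect (tensorEffect e₁ e₂) (tensorEffect f₁ f₂) := by
  simp only [tensorEffect, ← tensorHom_comp_tensorHom, Category.assoc]
  have h : ((λ_ (𝟙_ C)).hom ⊗ₘ (λ_ (𝟙_ C)).hom) ≫ (λ_ (𝟙_ C)).hom =
      (λ_ (𝟙_ C)).hom ▷ (𝟙_ C ⊗ 𝟙_ C) ≫ (λ_ (𝟙_ C ⊗ 𝟙_ C)).hom ≫ (λ_ (𝟙_ C)).hom := by monoidal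
  rw [← tensorμ_natural_assoc, h, ← leftUnitor_monoidal_assoc, h]

section Linear

variable {C : Type u} [Category.{v} C] [Preadditive C] [MonoidalCategory C]
  [MonoidalPreadditive C] {A B : C}

lemma tensorEffect_add_right (e : A ⟶ 𝟙_ C) (f g : B ⟶ 𝟙_ C) :
    tensorEffect e (f + g) = tensorEffect e f + tensorEffect e g := by
  simp only [tensorEffect, MonoidalPreadditive.tensor_add, Preadditive.add_comp]

lemma tensorEffect_add_left (e f : A ⟶ 𝟙_ C) (g : B ⟶ 𝟙_ C) :
    tensorEffect (e + f) g = tensorEffect e g + tensorEffect f g := by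
  simp only [tensorEffect, MonoidalPreadditive.add_tensor, Preadditive.add_comp]

lemma tensorEffect_sub_right (e : A ⟶ 𝟙_ C) (f g : B ⟶ 𝟙_ C) :
    tensorEffect e (f - g) = tensorEffect e f - tensorEffect e g := by
  rw [eq_sub_iff_add_eq, ← tensorEffect_add_right, sub_add_cancel]

lemma tensorEffect_sub_left (e f : A ⟶ 𝟙_ C) (g : B ⟶ 𝟙_ C) :
    tensorEffect (e - f) g = tensorEffect e g - tensorEffect f g := by
  rw [eq_sub_iff_add_eq, ← tensorEffect_add_left, sub_add_cancel]

end Linear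

variable {C : Type u} [Category.{v} C] [Preadditive C] [Linear ℝ C] [MonoidalCategory C]
  [MonoidalPreadditive C] [MonoidalLinear ℝ C] [SymmetricCategory C] (T : GPT C)

section Membership

variable {T} {A B X Y : C}

lemma whiskerLeft_mem (A : C) {f : X ⟶ Y} (hf : f ∈ T.cone X Y) :
    A ◁ f ∈ T.cone (A ⊗ X) (A ⊗ Y) := by
  rw [← id_tensorHom]
  exact T.tensor_mem _ _ (T.id_mem A) hf

lemma whiskerRight_mem {f : X ⟶ Y} (hf : f ∈ T.cone X Y) (A : C) :
    f ▷ A ∈ T.cone (X ⊗ A) (Y ⊗ A) := by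
  rw [← tensorHom_id]
  exact T.tensor_mem _ _ hf (T.id_mem A)

lemma contractRight_mem {χ : X ⟶ A ⊗ B} (hχ : χ ∈ T.cone X (A ⊗ B)) {f : B ⟶ 𝟙_ C}
    (hf : f ∈ T.cone B (𝟙_ C)) : contractRight χ f ∈ T.cone X A :=
  T.comp_mem _ _ hχ (T.comp_mem _ _ (whiskerLeft_mem A hf) (T.rightUnitor_hom_mem A))

lemma contractLeft_mem {χ : X ⟶ A ⊗ B} (hχ : χ ∈ T.cone X (A ⊗ B)) {e : A ⟶ 𝟙_ C}
    (he : e ∈ T.cone A (𝟙_ C)) : contractLeft χ e ∈ T.cone X B :=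
  T.comp_mem _ _ hχ (T.comp_mem _ _ (whiskerRight_mem he B) (T.leftUnitor_hom_mem B))

lemma insertRight_mem {χ : A ⊗ B ⟶ X} (hχ : χ ∈ T.cone (A ⊗ B) X) {t : 𝟙_ C ⟶ B}
    (ht : t ∈ T.cone (𝟙_ C) B) : insertRight χ t ∈ T.cone A X :=
  T.comp_mem _ _ (T.rightUnitor_inv_mem A) (T.comp_mem _ _ (whiskerLeft_mem A ht) hχ)

lemma insertLeft_mem {χ : A ⊗ B ⟶ X} (hχ : χ ∈ T.cone (A ⊗ B) X) {s : 𝟙_ C ⟶ A}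
    (hs : s ∈ T.cone (𝟙_ C) A) : insertLeft χ s ∈ T.cone B X :=
  T.comp_mem _ _ (T.leftUnitor_inv_mem B) (T.comp_mem _ _ (whiskerRight_mem hs B) hχ)

lemma tensorμ_mem (X₁ X₂ Y₁ Y₂ : C) :
    tensorμ X₁ X₂ Y₁ Y₂ ∈ T.cone ((X₁ ⊗ X₂) ⊗ Y₁ ⊗ Y₂) ((X₁ ⊗ Y₁) ⊗ X₂ ⊗ Y₂) :=
  T.comp_mem _ _ (T.associator_hom_mem _ _ _) <|
    T.comp_mem _ _ (whiskerLeft_mem _ (T.associator_inv_mem _ _ _)) <|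
    T.comp_mem _ _ (whiskerLeft_mem _ (whiskerRight_mem (T.braiding_mem _ _) _)) <|
    T.comp_mem _ _ (whiskerLeft_mem _ (T.associator_hom_mem _ _ _)) (T.associator_inv_mem _ _ _)

lemma num_nonneg {s : 𝟙_ C ⟶ A} {e : A ⟶ 𝟙_ C} (hs : s ∈ T.cone (𝟙_ C) A)
    (he : e ∈ T.cone A (𝟙_ C)) : 0 ≤ T.num (s ≫ e) :=
  (T.mem_cone_unit _).1 (T.comp_mem _ _ hs he)

end Membership

/-! ### Order, compactness and state-effect duality -/

lemma le_iff {A B : C} {f g : A ⟶ B} : T.Le f g ↔ g - f ∈ T.cone A B :=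
  ⟨fun ⟨z, hz, h⟩ => by rwa [← h, add_sub_cancel_left], fun h => ⟨_, h, add_sub_cancel f g⟩⟩

lemma exists_eq_sub {A B : C} (f : A ⟶ B) :
    ∃ a ∈ T.cone A B, ∃ b ∈ T.cone A B, f = a - b := by
  have hf : f ∈ Submodule.span ℝ (T.cone A B : Set (A ⟶ B)) := by
    rw [T.span_cone]
    trivial
  induction hf using Submodule.span_induction with
  | mem x hx => exact ⟨x, hx, 0, zero_mem _, by simp⟩
  | zero => exact ⟨0, zero_mem _, 0, zero_mem _, by simp⟩
  | add x y _ _ hx hy =>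
    obtain ⟨a, ha, b, hb, rfl⟩ := hx
    obtain ⟨a', ha', b', hb', rfl⟩ := hy
    exact ⟨a + a', add_mem ha ha', b + b', add_mem hb hb', by abel⟩
  | smul r x _ hx =>
    obtain ⟨a, ha, b, hb, rfl⟩ := hx
    rcases le_total 0 r with hr | hr
    · exact ⟨r • a, PointedCone.smul_mem _ hr ha, r • b, PointedCone.smul_mem _ hr hb,
        smul_sub _ _ _⟩
    · refine ⟨(-r) • b, PointedCone.smul_mem _ (neg_nonneg.2 hr) hb, (-r) • a,
        PointedCone.smul_mem _ (neg_nonneg.2 hr) ha, ?_⟩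
      rw [smul_sub, neg_smul, neg_smul]
      abel

/-- Effects are determined by their values on states. -/
lemma effect_eq_zero {A : C} (e : A ⟶ 𝟙_ C)
    (h : ∀ s ∈ T.cone (𝟙_ C) A, T.num (s ≫ e) = 0) : e = 0 := by
  obtain ⟨a, ha, b, hb, rfl⟩ := T.exists_eq_sub e
  rw [sub_eq_zero]
  refine T.tomography a b ha hb fun D s f hs hf => ?_
  -- An effect on `𝟙_ C ⊗ D` is an effect on `D`; applying it first turns the joint state into a
  -- state of `A`, so no ancilla is needed.
  have key : ∀ c : A ⟶ 𝟙_ C, s ≫ c ▷ D ≫ f = contractRight s ((λ_ D).inv ≫ f) ≫ c := by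
    intro c
    rw [contractRight_comp, ← whiskerRight_comp_leftUnitor_comp, Iso.hom_inv_id_assoc]
  have := h _ (contractRight_mem hs (T.comp_mem _ _ (T.leftUnitor_inv_mem D) hf))
  rw [Preadditive.comp_sub, map_sub, sub_eq_zero] at this
  rw [key, key, this]

lemma exists_smul_discard_sub_mem {A : C} {e : A ⟶ 𝟙_ C} (he : e ∈ T.cone A (𝟙_ C)) :
    ∃ r : ℝ, 0 < r ∧ T.discard A - r • e ∈ T.cone A (𝟙_ C) := by
  obtain ⟨r, hr, h⟩ := T.exists_subcausal_smul e he
  rw [T.discard_unit, Category.comp_id] at h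
  exact ⟨r, hr, h⟩

/-- The discarding effect is an order unit. -/
lemma exists_add_smul_discard_mem {A : C} (e : A ⟶ 𝟙_ C) :
    ∃ r : ℝ, e + r • T.discard A ∈ T.cone A (𝟙_ C) := by
  obtain ⟨a, ha, b, hb, rfl⟩ := T.exists_eq_sub e
  obtain ⟨r, hr, h⟩ := T.exists_smul_discard_sub_mem hb
  refine ⟨r⁻¹, ?_⟩
  have := add_mem ha (PointedCone.smul_mem _ (inv_nonneg.2 hr.le) h)
  rw [smul_sub, inv_smul_smul₀ hr.ne'] at this
  convert this using 1
  abel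

/-- Any effect on `B ⊗ D` is dominated by a multiple of discarding, so a process whose discarded
output is nonpositive gives zero in every tomographic test. This is the recession condition behind
compactness. -/
lemma eq_zero_of_neg_discard_mem {A B : C} {z : A ⟶ B} (hz : z ∈ T.cone A B)
    (h : -(z ≫ T.discard B) ∈ T.cone A (𝟙_ C)) : z = 0 := by
  refine T.tomography z 0 hz (zero_mem _) fun D s e hs he => ?_
  obtain ⟨r, hr, hre⟩ := T.exists_smul_discard_sub_mem he
  have hsz : s ≫ z ▷ D ∈ T.cone (𝟙_ C) (B ⊗ D) := T.comp_mem _ _ hs (whiskerRight_mem hz D)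
  have h0 := num_nonneg hsz he
  have h1 := num_nonneg hsz hre
  have h2 := num_nonneg (contractRight_mem hs (T.discard_mem D)) h
  have h3 : z ▷ D ≫ T.discard (B ⊗ D) = tensorEffect (z ≫ T.discard B) (T.discard D) := by
    rw [T.discard_tensor', ← whiskerRight_comp_leftUnitor_comp,
      ← whiskerRight_comp_leftUnitor_comp, comp_whiskerRight, Category.assoc]
  rw [Preadditive.comp_sub, map_sub, Category.assoc, h3, Linear.comp_smul, map_smul,
    smul_eq_mul] at h1
  rw [Preadditive.comp_neg, map_neg, contractRight_comp] at h2
  rw [Category.assoc] at h0 h1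
  simp only [MonoidalPreadditive.zero_whiskerRight, Limits.zero_comp, Limits.comp_zero, map_zero]
  have : r * T.num (s ≫ z ▷ D ≫ e) ≤ 0 := by linarith
  nlinarith

lemma isCompact_subcausal (A B : C) :
    @IsCompact _ (moduleTopology ℝ (A ⟶ B)) {f | T.IsSubcausal f} := by
  have := T.finite A B
  have h := isCompact_moduleTopology_of_recession (T.cone A B) (T.isClosed_cone A B)
    (T.cone A (𝟙_ C)) (T.isClosed_cone A (𝟙_ C)) (Linear.rightComp ℝ A (T.discard B))
    (T.discard A) fun x hx h => T.eq_zero_of_neg_discard_mem hx h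
  convert h using 3
  rw [IsSubcausal, le_iff, Linear.rightComp_apply]

/-- The pairing of states and effects. -/
noncomputable def pairing (A : C) : (𝟙_ C ⟶ A) →ₗ[ℝ] (A ⟶ 𝟙_ C) →ₗ[ℝ] ℝ :=
  LinearMap.mk₂ ℝ (fun s e => T.num (s ≫ e)) (by simp) (by simp) (by simp) (by simp)

@[simp]
lemma pairing_apply {A : C} (s : 𝟙_ C ⟶ A) (e : A ⟶ 𝟙_ C) : T.pairing A s e = T.num (s ≫ e) :=
  rfl

/-- Under the No-Restriction Hypothesis positive functionals on effects are given by states. -/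
lemma NoRestriction.exists_state {T : GPT C} (hNR : T.NoRestriction) {A : C}
    (σ : (A ⟶ 𝟙_ C) →ₗ[ℝ] ℝ) (hσ : ∀ e ∈ T.cone A (𝟙_ C), 0 ≤ σ e) :
    ∃ s ∈ T.cone (𝟙_ C) A, ∀ e, T.num (s ≫ e) = σ e := by
  have := T.finite A (𝟙_ C)
  have := T.finite (𝟙_ C) A
  -- States separate effects, so in finite dimension every functional on effects is pairing with
  -- some vector `s`. Positivity of `s` follows by contradiction: a functional separating it from
  -- the closed state cone would be an effect.
  have hsurj : Function.Surjective (T.pairing A) := by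
    rw [← LinearMap.flip_injective_iff₁, ← LinearMap.ker_eq_bot, LinearMap.ker_eq_bot']
    intro e he
    exact T.effect_eq_zero e fun s _ => LinearMap.congr_fun he s
  obtain ⟨s, hs⟩ := hsurj σ
  have hs' : ∀ e, T.num (s ≫ e) = σ e := fun e => LinearMap.congr_fun hs e
  refine ⟨s, ?_, hs'⟩
  by_contra hsK
  obtain ⟨φ, hφ, hφs⟩ :=
    PointedCone.exists_dual_neg_of_isClosed_moduleTopology _ (T.isClosed_cone (𝟙_ C) A) hsK
  obtain ⟨e, he, heφ⟩ := hNR A φ hφ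
  have := hσ e he
  rw [← hs', heφ] at this
  linarith

end GPT

/-! ### Conic duality -/

/-- Conic duality: the optimal value of a conic program whose constraint bound is an order unit is
attained by a positive functional. -/
lemma exists_dual_of_order_unit {V E : Type*} [AddCommGroup V] [Module ℝ V] [AddCommGroup E]
    [Module ℝ E] (K : PointedCone ℝ V) (P : PointedCone ℝ E) (δ : V →ₗ[ℝ] E) (d : E)
    (Φ : V →ₗ[ℝ] ℝ) (α : ℝ) (hd : ∀ e, ∃ r : ℝ, e + r • d ∈ P) (hdP : d ∈ P)
    (hpos : ∀ x ∈ K, ∀ r : ℝ, r • d - δ x ∈ P → 0 ≤ r)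
    (hα : ∀ x ∈ K, d - δ x ∈ P → Φ x ≤ α) :
    ∃ σ : E →ₗ[ℝ] ℝ, (∀ e ∈ P, 0 ≤ σ e) ∧ σ d = α ∧ ∀ x ∈ K, Φ x ≤ σ (δ x) := by
  have hd0 : d ≠ 0 := by
    intro h
    have := hpos 0 (zero_mem _) (-1) (by simp [h])
    linarith
  -- Pairs of a budget and a value achievable within it. The functional `(r • d, t) ↦ r * α - t` is
  -- nonnegative on `Q` by optimality; its Riesz extension, restricted to `E`, is the dual solution.
  let Q : PointedCone ℝ (E × ℝ) :=
    { carrier := {q | ∃ x ∈ K, q.1 - δ x ∈ P ∧ q.2 ≤ Φ x}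
      zero_mem' := ⟨0, zero_mem _, by simp, by simp⟩
      add_mem' := by
        rintro q q' ⟨x, hx, hq, ht⟩ ⟨x', hx', hq', ht'⟩
        refine ⟨x + x', add_mem hx hx', ?_, ?_⟩
        · have := add_mem hq hq'
          rwa [sub_add_sub_comm, ← map_add] at this
        · rw [map_add]
          exact add_le_add ht ht'
      smul_mem' := by
        rintro ⟨c, hc⟩ q ⟨x, hx, hq, ht⟩
        refine ⟨c • x, PointedCone.smul_mem _ hc hx, ?_, ?_⟩
        · have := PointedCone.smul_mem _ hc hq
          rwa [smul_sub, ← map_smul] at this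
        · rw [map_smul]
          exact mul_le_mul_of_nonneg_left ht hc }
  let f : E × ℝ →ₗ.[ℝ] ℝ :=
    (LinearPMap.mkSpanSingleton d α hd0).coprod ((-LinearMap.id : ℝ →ₗ[ℝ] ℝ).toPMap ⊤)
  have hf : ∀ (r t : ℝ) (h : (r • d, t) ∈ f.domain), f ⟨(r • d, t), h⟩ = r * α - t := by
    intro r t h
    have h1 : LinearPMap.mkSpanSingleton d α hd0 ⟨r • d, h.1⟩ = r • α :=
      LinearPMap.mkSpanSingleton'_apply _ _ _ _ _
    exact (congrArg (· + -t) h1).trans (sub_eq_add_neg _ _).symm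
  have hmem : ∀ r t : ℝ, (r • d, t) ∈ f.domain := fun r t =>
    ⟨Submodule.mem_span_singleton.2 ⟨r, rfl⟩, trivial⟩
  obtain ⟨g, hg, hgQ⟩ := riesz_extension Q f
    (by
      rintro ⟨⟨e, t⟩, he⟩ ⟨x, hx, hex, hxt⟩
      obtain ⟨r, rfl⟩ := Submodule.mem_span_singleton.1 he.1
      rw [hf]
      have hr : 0 ≤ r := hpos x hx r hex
      -- The budget `r` may be zero, so it is enlarged by `ε` before rescaling to 1.
      have hle : ∀ ε : ℝ, 0 < ε → Φ x ≤ (r + ε) * α := by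
        intro ε hε
        have hrε : 0 < r + ε := by linarith
        have h1 := hα ((r + ε)⁻¹ • x) (PointedCone.smul_mem _ (inv_nonneg.2 hrε.le) hx) (by
          have h2 := PointedCone.smul_mem _ (inv_nonneg.2 hrε.le)
            (add_mem hex (PointedCone.smul_mem _ hε.le hdP))
          convert h2 using 1
          have h3 : r • d - δ x + ε • d = (r + ε) • d - δ x := by
            rw [add_smul]
            abel
          rw [h3, smul_sub, inv_smul_smul₀ hrε.ne', map_smul])
        rw [map_smul, smul_eq_mul, inv_mul_le_iff₀ hrε] at h1
        exact h1
      have hlim : Φ x ≤ r * α := by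
        have ht : Filter.Tendsto (fun ε : ℝ => (r + ε) * α) (nhdsWithin 0 (Set.Ioi 0))
            (nhds (r * α)) := by
          have : Continuous fun ε : ℝ => (r + ε) * α := by fun_prop
          simpa using (this.tendsto 0).mono_left nhdsWithin_le_nhds
        refine ge_of_tendsto ht ?_
        filter_upwards [self_mem_nhdsWithin] with ε hε using hle ε hε
      simp only at hxt
      linarith)
    (by
      rintro ⟨e, t⟩
      -- The order unit moves `e` into `P` and `-t` cancels the value, so every translate of the
      -- domain meets `Q`.
      obtain ⟨r, hr⟩ := hd e
      exact ⟨⟨_, hmem r (-t)⟩, 0, zero_mem _, by simpa [add_comm] using hr, by simp⟩)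
  refine ⟨g ∘ₗ LinearMap.inl ℝ E ℝ, fun e he => hgQ _ ⟨0, zero_mem _, by simpa using he, by simp⟩,
    ?_, fun x hx => ?_⟩
  · have := hg ⟨_, hmem 1 0⟩
    rw [hf] at this
    simpa using this
  · have h1 := hgQ (δ x, Φ x) ⟨x, hx, by simp, le_rfl⟩
    have h2 := hg ⟨_, hmem 0 (Φ x)⟩
    rw [hf] at h2
    have h3 : g (δ x, Φ x) = g (δ x, 0) + g (0, Φ x) := by
      rw [← map_add]
      simp
    simp only [zero_smul, zero_mul, zero_sub] at h2
    change Φ x ≤ g (δ x, 0)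
    linarith

/-! ### Counterfeiting values and their submultiplicativity -/

namespace GPT

variable {C : Type u} [Category.{v} C] [Preadditive C] [Linear ℝ C] [MonoidalCategory C]
  [MonoidalPreadditive C] [MonoidalLinear ℝ C] [SymmetricCategory C] {T : GPT C} {A B : C}

lemma num_comp_le {s : 𝟙_ C ⟶ A} (hs : s ∈ T.cone (𝟙_ C) A) {e f : A ⟶ 𝟙_ C} (h : T.Le e f) :
    T.num (s ≫ e) ≤ T.num (s ≫ f) := by
  have := num_nonneg hs (T.le_iff.1 h)
  rw [Preadditive.comp_sub, map_sub] at this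
  linarith

lemma IsCausal.num_discard {s : 𝟙_ C ⟶ A} (hs : T.IsCausal s) : T.num (s ≫ T.discard A) = 1 := by
  rw [hs.2, T.discard_unit, T.num_id]

lemma zero_isSubcausal (A B : C) : T.IsSubcausal (0 : A ⟶ B) :=
  ⟨zero_mem _, T.le_iff.2 (by simpa using T.discard_mem A)⟩

lemma IsSubcausal.num_comp_comp_le {s : 𝟙_ C ⟶ A} (hs : s ∈ T.cone (𝟙_ C) A) {χ : A ⟶ B}
    (hχ : T.IsSubcausal χ) {e : B ⟶ 𝟙_ C} (he : T.Le e (T.discard B)) :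
    T.num (s ≫ χ ≫ e) ≤ T.num (s ≫ T.discard A) := by
  refine le_trans ?_ (num_comp_le hs hχ.2)
  rw [← Category.assoc, ← Category.assoc]
  exact num_comp_le (T.comp_mem _ _ hs hχ.1) he

namespace BankStrategy

variable (S : T.BankStrategy A) (S' : T.BankStrategy B)

/-- The success probability as a linear functional of the counterfeiting machine. -/
noncomputable def successLinear : (A ⟶ A ⊗ A) →ₗ[ℝ] ℝ where
  toFun := S.successProb
  map_add' χ χ' := by
    simp only [successProb, Preadditive.add_comp, Preadditive.comp_add, map_add, mul_add,
      Finset.sum_add_distrib]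
  map_smul' r χ := by
    simp only [successProb, Linear.smul_comp, Linear.comp_smul, map_smul, smul_eq_mul,
      RingHom.id_apply, Finset.mul_sum]
    exact Finset.sum_congr rfl fun i _ => by ring

@[simp]
lemma successLinear_apply (χ : A ⟶ A ⊗ A) : S.successLinear χ = S.successProb χ := rfl

lemma num_verify_le_one {χ : A ⟶ A ⊗ A} (hχ : T.IsSubcausal χ) (i : S.ι) :
    T.num (S.s i ≫ χ ≫ tensorEffect (S.e i) (S.e i)) ≤ 1 := by
  rw [← (S.s_causal i).num_discard]
  exact hχ.num_comp_comp_le (S.s_causal i).1 (T.tensorEffect_le (S.e_mem i) (S.e_le i) (S.e_le i))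

lemma successProb_le_one {χ : A ⟶ A ⊗ A} (hχ : T.IsSubcausal χ) : S.successProb χ ≤ 1 := by
  rw [← S.p_sum]
  exact Finset.sum_le_sum fun i _ =>
    mul_le_of_le_one_right (S.p_pos i).le (S.num_verify_le_one hχ i)

lemma successProb_le_alpha {χ : A ⟶ A ⊗ A} (hχ : T.IsSubcausal χ) : S.successProb χ ≤ S.alpha := by
  refine le_csSup ⟨1, ?_⟩ ⟨χ, hχ, rfl⟩
  rintro _ ⟨χ', hχ', rfl⟩
  exact S.successProb_le_one hχ'

lemma alpha_nonneg : 0 ≤ S.alpha := by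
  have := S.successProb_le_alpha (zero_isSubcausal A (A ⊗ A))
  rwa [← successLinear_apply, map_zero] at this

lemma alpha_le {a : ℝ} (h : ∀ χ : A ⟶ A ⊗ A, T.IsSubcausal χ → S.successProb χ ≤ a) :
    S.alpha ≤ a := by
  refine csSup_le ⟨_, 0, zero_isSubcausal A (A ⊗ A), rfl⟩ ?_
  rintro _ ⟨χ, hχ, rfl⟩
  exact h χ hχ

/-- The counterfeiting value is attained. -/
lemma exists_successProb_eq_alpha :
    ∃ χ : A ⟶ A ⊗ A, T.IsSubcausal χ ∧ S.successProb χ = S.alpha := by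
  obtain ⟨χ, hχ, hmax⟩ := (T.isCompact_subcausal A (A ⊗ A)).exists_linearMap_le
    ⟨0, zero_isSubcausal A (A ⊗ A)⟩ S.successLinear
  exact ⟨χ, hχ, le_antisymm (S.successProb_le_alpha hχ) (S.alpha_le hmax)⟩

/-- Duality applies because discarding is an order unit. The bound holds on the whole cone, so it
can be used for machines that are not subcausal. -/
lemma exists_dual_state (hNR : T.NoRestriction) :
    ∃ σ ∈ T.cone (𝟙_ C) A, T.num (σ ≫ T.discard A) = S.alpha ∧
      ∀ χ ∈ T.cone A (A ⊗ A), S.successProb χ ≤ T.num (σ ≫ χ ≫ T.discard (A ⊗ A)) := by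
  obtain ⟨s, hs⟩ := T.exists_causal_state A
  have hs1 : T.num (s ≫ T.discard A) = 1 := by rw [hs.2, T.num_id]
  obtain ⟨φ, hφ, hφd, hφS⟩ := exists_dual_of_order_unit (T.cone A (A ⊗ A)) (T.cone A (𝟙_ C))
    (Linear.rightComp ℝ A (T.discard (A ⊗ A))) (T.discard A) S.successLinear S.alpha
    T.exists_add_smul_discard_mem (T.discard_mem A)
    (fun χ hχ r hr => by
      have h1 := num_nonneg hs.1 hr
      have h2 := num_nonneg hs.1 (T.comp_mem _ _ hχ (T.discard_mem (A ⊗ A)))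
      simp only [Linear.rightComp_apply, Preadditive.comp_sub, Linear.comp_smul, map_sub, map_smul,
        smul_eq_mul, hs1, mul_one] at h1
      linarith)
    (fun χ hχ h => S.successProb_le_alpha ⟨hχ, T.le_iff.2 h⟩)
  obtain ⟨σ, hσ, hσφ⟩ := hNR.exists_state φ hφ
  refine ⟨σ, hσ, by rw [hσφ, hφd], fun χ hχ => ?_⟩
  rw [hσφ]
  exact hφS χ hχ

/-- Counterfeiting values are submultiplicative. -/
lemma alpha_prod_le (hNR : T.NoRestriction) : (S.prod S').alpha ≤ S.alpha * S'.alpha := by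
  obtain ⟨σ, hσ, hσα, hσS⟩ := S.exists_dual_state hNR
  obtain ⟨τ, hτ, hτα, hτS⟩ := S'.exists_dual_state hNR
  refine alpha_le _ fun χ hχ => ?_
  set ψ := χ ≫ tensorμ A B A B with hψ
  have hψK : ψ ∈ T.cone (A ⊗ B) ((A ⊗ A) ⊗ B ⊗ B) := T.comp_mem _ _ hχ.1 (tensorμ_mem A B A B)
  have hreorder : ∀ (r : 𝟙_ C ⟶ A ⊗ B) (e f : A ⟶ 𝟙_ C) (e' f' : B ⟶ 𝟙_ C),
      r ≫ χ ≫ tensorEffect (tensorEffect e e') (tensorEffect f f') =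
        r ≫ ψ ≫ tensorEffect (tensorEffect e f) (tensorEffect e' f') := by
    intro r e f e' f'
    rw [hψ, Category.assoc, tensorμ_comp_tensorEffect]
  let E : S'.ι → (B ⊗ B ⟶ 𝟙_ C) := fun j => tensorEffect (S'.e j) (S'.e j)
  -- The machine on `A` that remains when the `B` part is the `j`-th note and both its copies pass.
  let ψ₁ : S'.ι → (A ⟶ A ⊗ A) := fun j => contractRight (insertRight ψ (S'.s j)) (E j)
  have hψ₁K : ∀ j, ψ₁ j ∈ T.cone A (A ⊗ A) := fun j =>
    contractRight_mem (insertRight_mem hψK (S'.s_causal j).1)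
      (T.tensorEffect_mem (S'.e_mem j) (S'.e_mem j))
  let ψ₂ : B ⟶ B ⊗ B := contractLeft (insertLeft ψ σ) (T.discard (A ⊗ A))
  have hψ₂K : ψ₂ ∈ T.cone B (B ⊗ B) :=
    contractLeft_mem (insertLeft_mem hψK hσ) (T.discard_mem _)
  have h₁ : ∀ j (r : 𝟙_ C ⟶ A) (e : A ⊗ A ⟶ 𝟙_ C),
      r ≫ ψ₁ j ≫ e = tensorState r (S'.s j) ≫ ψ ≫ tensorEffect e (E j) := by
    intro j r e
    rw [contractRight_comp, comp_insertRight_comp]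
  have h₂ : ∀ (r : 𝟙_ C ⟶ B) (e : B ⊗ B ⟶ 𝟙_ C),
      r ≫ ψ₂ ≫ e = tensorState σ r ≫ ψ ≫ tensorEffect (T.discard (A ⊗ A)) e := by
    intro r e
    rw [contractLeft_comp, comp_insertLeft_comp]
  calc (S.prod S').successProb χ
      = ∑ j, S'.p j * S.successProb (ψ₁ j) := by
        change ∑ i : S.ι × S'.ι, S.p i.1 * S'.p i.2 *
          T.num (tensorState (S.s i.1) (S'.s i.2) ≫ χ ≫
            tensorEffect (tensorEffect (S.e i.1) (S'.e i.2))
              (tensorEffect (S.e i.1) (S'.e i.2))) = _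
        rw [Fintype.sum_prod_type_right]
        refine Finset.sum_congr rfl fun j _ => ?_
        rw [successProb, Finset.mul_sum]
        refine Finset.sum_congr rfl fun i _ => ?_
        rw [h₁, hreorder]
        ring
    _ ≤ ∑ j, S'.p j * T.num (σ ≫ ψ₁ j ≫ T.discard (A ⊗ A)) := by
        gcongr with j
        · exact (S'.p_pos j).le
        · exact hσS _ (hψ₁K j)
    _ = S'.successProb ψ₂ := by
        refine Finset.sum_congr rfl fun j _ => ?_
        rw [h₁, h₂]
    _ ≤ T.num (τ ≫ ψ₂ ≫ T.discard (B ⊗ B)) := hτS _ hψ₂K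
    _ = T.num (tensorState σ τ ≫ χ ≫ T.discard ((A ⊗ B) ⊗ (A ⊗ B))) := by
        rw [h₂]
        simp only [T.discard_tensor', hreorder]
    _ ≤ T.num (tensorState σ τ ≫ T.discard (A ⊗ B)) :=
        num_comp_le (T.comp_mem _ _ (T.leftUnitor_inv_mem _) (T.tensor_mem _ _ hσ hτ)) hχ.2
    _ = S.alpha * S'.alpha := by
        rw [T.discard_tensor', tensorState_comp_tensorEffect, T.num_comp, hσα, hτα, mul_comm]

/-- The exponent is shifted because `copies n` consists of `n + 1` factors. -/
lemma alpha_copies_le (hNR : T.NoRestriction) (n : ℕ) :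
    (S.copies n).alpha ≤ S.alpha ^ (n + 1) := by
  induction n with
  | zero =>
    rw [zero_add, pow_one]
    exact le_rfl
  | succ n ih =>
    rw [pow_succ]
    exact (alpha_prod_le _ _ hNR).trans (mul_le_mul_of_nonneg_right ih S.alpha_nonneg)

end BankStrategy

end GPT

/-! ### Perfect counterfeiting implies a classical ensemble -/

namespace GPT

variable {C : Type u} [Category.{v} C] [Preadditive C] [Linear ℝ C] [MonoidalCategory C]
  [MonoidalPreadditive C] [MonoidalLinear ℝ C] [SymmetricCategory C] {T : GPT C} {A B : C}

lemma isSubcausal_state_iff {s : 𝟙_ C ⟶ A} :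
    T.IsSubcausal s ↔ s ∈ T.cone (𝟙_ C) A ∧ T.num (s ≫ T.discard A) ≤ 1 := by
  rw [IsSubcausal, le_iff, mem_cone_unit, map_sub, T.discard_unit, T.num_id, sub_nonneg]

lemma isSubcausal_effect_iff {e : A ⟶ 𝟙_ C} :
    T.IsSubcausal e ↔ e ∈ T.cone A (𝟙_ C) ∧ T.Le e (T.discard A) := by
  rw [IsSubcausal, T.discard_unit, Category.comp_id]

lemma discard_isSubcausal (A : C) : T.IsSubcausal (T.discard A) :=
  isSubcausal_effect_iff.2 ⟨T.discard_mem A, T.le_iff.2 (by simp)⟩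

lemma IsSubcausal.discard_sub {e : A ⟶ 𝟙_ C} (he : T.IsSubcausal e) :
    T.IsSubcausal (T.discard A - e) := by
  rw [isSubcausal_effect_iff, le_iff] at he ⊢
  exact ⟨he.2, by simpa using he.1⟩

lemma IsSubcausal.comp_tensorEffect {X : C} {χ : X ⟶ A ⊗ B} (hχ : T.IsSubcausal χ)
    {e : A ⟶ 𝟙_ C} (he : T.IsSubcausal e) {f : B ⟶ 𝟙_ C} (hf : T.IsSubcausal f) :
    T.IsSubcausal (χ ≫ tensorEffect e f) := by
  rw [isSubcausal_effect_iff] at he hf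
  refine isSubcausal_effect_iff.2
    ⟨T.comp_mem _ _ hχ.1 (T.tensorEffect_mem he.1 hf.1), T.le_iff.2 ?_⟩
  have h1 := T.le_iff.1 (T.tensorEffect_le he.1 he.2 hf.2)
  have h2 := add_mem (T.le_iff.1 hχ.2) (T.comp_mem _ _ hχ.1 h1)
  rwa [Preadditive.comp_sub, sub_add_sub_cancel] at h2

/-- The process `χ` clones `s`: to product effects, its output looks like two copies of `s`. -/
def Clones (T : GPT C) (χ : A ⟶ A ⊗ A) (s : 𝟙_ C ⟶ A) : Prop :=
  ∀ e f : A ⟶ 𝟙_ C, T.IsSubcausal f →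
    T.num (s ≫ χ ≫ tensorEffect e f) = T.num (s ≫ e) * T.num (s ≫ f)

/-- A machine whose two outputs pass a sharp verification clones the verified state. -/
lemma clones_of_sharp {χ : A ⟶ A ⊗ A} (hχ : T.IsSubcausal χ) {s : 𝟙_ C ⟶ A} (hs : T.IsCausal s)
    {e : A ⟶ 𝟙_ C} (he : T.IsSubcausal e)
    (hsharp : ∀ t : 𝟙_ C ⟶ A, T.IsSubcausal t → T.num (t ≫ e) = 1 → t = s)
    (h : T.num (s ≫ χ ≫ tensorEffect e e) = 1) : T.Clones χ s := by
  obtain ⟨heK, hed⟩ := isSubcausal_effect_iff.1 he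
  have hd := discard_isSubcausal (T := T) A
  have hle : ∀ f g : A ⟶ 𝟙_ C, T.IsSubcausal f → T.IsSubcausal g →
      T.num (s ≫ χ ≫ tensorEffect f g) ≤ 1 := by
    intro f g hf hg
    rw [← hs.num_discard]
    exact num_comp_le hs.1 (isSubcausal_effect_iff.1 (hχ.comp_tensorEffect hf hg)).2
  set ω := s ≫ χ with hω
  have hωK : ω ∈ T.cone (𝟙_ C) (A ⊗ A) := T.comp_mem _ _ hs.1 hχ.1
  simp only [← Category.assoc] at h hle
  rw [← hω] at h
  simp only [← hω] at hle
  -- The unnormalised right output, given acceptance on the left, is itself accepted with certainty.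
  have h1 : contractLeft ω e = s := by
    refine hsharp _ (isSubcausal_state_iff.2 ⟨contractLeft_mem hωK heK, ?_⟩) ?_
    · rw [contractLeft_comp]
      exact hle _ _ he hd
    · rw [contractLeft_comp, h]
  have h2 : ∀ f : A ⟶ 𝟙_ C, T.num (ω ≫ tensorEffect e f) = T.num (s ≫ f) := by
    intro f
    rw [← contractLeft_comp, h1]
  intro k f hf
  obtain ⟨hfK, hfd⟩ := isSubcausal_effect_iff.1 hf
  have hwK := contractRight_mem hωK hfK
  have hdf := hf.discard_sub
  obtain ⟨hdfK, -⟩ := isSubcausal_effect_iff.1 hdf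
  have h3 := num_comp_le hwK hed
  have h4 := num_comp_le (contractRight_mem hωK hdfK) hed
  have h5 := hle _ _ hd hd
  have h6 := num_nonneg hs.1 hfK
  simp only [contractRight_comp] at h3 h4
  rw [h2] at h3 h4
  rw [tensorEffect_sub_right] at h4
  simp only [Preadditive.comp_sub, map_sub, hs.num_discard] at h4
  -- Replacing `e` by discarding can only raise the numbers for `f` and for `discard A - f`, but
  -- their sum is already 1.
  have h7 : T.num (ω ≫ tensorEffect (T.discard A) f) = T.num (s ≫ f) := by linarith
  -- Given outcome `f` on the right, the normalised left output passes `e` with certainty, so it is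
  -- `s`.
  have h8 : contractRight ω f = T.num (s ≫ f) • s := by
    rcases h6.eq_or_lt with h0 | h0
    · rw [← h0, zero_smul]
      refine T.eq_zero_of_neg_discard_mem hwK ?_
      rw [contractRight_comp, T.mem_cone_unit, map_neg, h7, ← h0, neg_zero]
    · rw [← inv_smul_eq_iff₀ h0.ne']
      refine hsharp _ (isSubcausal_state_iff.2
        ⟨PointedCone.smul_mem _ (inv_nonneg.2 h6) hwK, ?_⟩) ?_
      · rw [Linear.smul_comp, map_smul, contractRight_comp, h7, smul_eq_mul,
          inv_mul_cancel₀ h0.ne']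
      · rw [Linear.smul_comp, map_smul, contractRight_comp, h2, smul_eq_mul,
          inv_mul_cancel₀ h0.ne']
  rw [← Category.assoc, ← hω, ← contractRight_comp, h8, Linear.smul_comp, map_smul, smul_eq_mul,
    mul_comm]

/-- If the states `t j` are cloned, then an effect that singles out `t i` can be sharpened to one
that separates it from the others with certainty. -/
lemma exists_separating_effect {ι : Type*} [Fintype ι] {χ : A ⟶ A ⊗ A} (hχ : T.IsSubcausal χ)
    (t : ι → (𝟙_ C ⟶ A)) (ht : ∀ i, T.IsCausal (t i)) (hclone : ∀ i, T.Clones χ (t i))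
    (i : ι) {e : A ⟶ 𝟙_ C} (he : T.IsSubcausal e) (hei : T.num (t i ≫ e) = 1)
    (hej : ∀ j, j ≠ i → T.num (t j ≫ e) ≠ 1) :
    ∃ g : A ⟶ 𝟙_ C, T.IsSubcausal g ∧ T.num (t i ≫ g) = 1 ∧
      ∀ j, j ≠ i → T.num (t j ≫ g) = 0 := by
  classical
  let φ : (A ⟶ 𝟙_ C) →ₗ[ℝ] ℝ := ∑ j ∈ Finset.univ.erase i, T.pairing A (t j)
  have hφ : ∀ h, φ h = ∑ j ∈ Finset.univ.erase i, T.num (t j ≫ h) := by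
    intro h
    simp [φ]
  -- Take `g` accepting `t i` with the least total acceptance of the other states. Testing `g` and
  -- `e` on two clones still accepts `t i` but multiplies each other acceptance by a factor below 1,
  -- so minimality makes all of them zero.
  obtain ⟨g, ⟨hg, hgi⟩, hmin⟩ := IsCompact.exists_linearMap_le
    (IsCompact.inter_linearMap_eq (T.isCompact_subcausal A (𝟙_ C)) (T.pairing A (t i)) 1)
    ⟨e, he, hei⟩ (-φ)
  refine ⟨g, hg, hgi, ?_⟩
  have hgK := (isSubcausal_effect_iff.1 hg).1
  have hlt : ∀ j, j ≠ i → T.num (t j ≫ e) < 1 := fun j hj =>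
    lt_of_le_of_ne ((ht j).num_discard ▸
      num_comp_le (ht j).1 (isSubcausal_effect_iff.1 he).2) (hej j hj)
  have h1 := hmin (χ ≫ tensorEffect g e) ⟨hχ.comp_tensorEffect hg he, by
    change T.num (t i ≫ χ ≫ tensorEffect g e) = 1
    rw [hclone i _ _ he, hei, mul_one]
    exact hgi⟩
  rw [LinearMap.neg_apply, LinearMap.neg_apply, neg_le_neg_iff, hφ, hφ, ← sub_nonpos,
    ← Finset.sum_sub_distrib] at h1
  have hterm : ∀ j, T.num (t j ≫ g) - T.num (t j ≫ χ ≫ tensorEffect g e) =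
      T.num (t j ≫ g) * (1 - T.num (t j ≫ e)) := by
    intro j
    rw [hclone j _ _ he]
    ring
  simp only [hterm] at h1
  have hnn : ∀ j ∈ Finset.univ.erase i, 0 ≤ T.num (t j ≫ g) * (1 - T.num (t j ≫ e)) :=
    fun j hj => mul_nonneg (num_nonneg (ht j).1 hgK)
      (sub_nonneg.2 (hlt j (Finset.ne_of_mem_erase hj)).le)
  have h0 := (Finset.sum_eq_zero_iff_of_nonneg hnn).1 (le_antisymm h1 (Finset.sum_nonneg hnn))
  intro j hj
  rcases mul_eq_zero.1 (h0 j (Finset.mem_erase.2 ⟨hj, Finset.mem_univ j⟩)) with h | h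
  · exact h
  · linarith [hlt j hj]

/-- Cloned states that are pairwise separated by effects are distinguished by one measurement. -/
lemma exists_measurement {n : ℕ} [NeZero n] {χ : A ⟶ A ⊗ A} (hχ : T.IsSubcausal χ)
    (t : Fin n → (𝟙_ C ⟶ A)) (ht : ∀ i, T.IsCausal (t i)) (hclone : ∀ i, T.Clones χ (t i))
    (g : Fin n → (A ⟶ 𝟙_ C)) (hg : ∀ k, T.IsSubcausal (g k))
    (hgt : ∀ j k, T.num (t j ≫ g k) = if j = k then 1 else 0) :
    ∃ f : Fin n → (A ⟶ 𝟙_ C), (∀ j, f j ∈ T.cone A (𝟙_ C)) ∧ ∑ j, f j = T.discard A ∧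
      ∀ j k, T.num (t j ≫ f k) = if j = k then 1 else 0 := by
  have main : ∀ P : Finset (Fin n), ∃ F : Fin n → (A ⟶ 𝟙_ C), (∀ k, F k ∈ T.cone A (𝟙_ C)) ∧
      T.discard A - ∑ k ∈ P, F k ∈ T.cone A (𝟙_ C) ∧
      ∀ k ∈ P, ∀ j, T.num (t j ≫ F k) = if j = k then 1 else 0 := by
    intro P
    induction P using Finset.induction_on with
    | empty => exact ⟨0, fun k => zero_mem _, by simpa using T.discard_mem A, by simp⟩
    | insert m P hm ih =>
      obtain ⟨F, hFK, hFsum, hF⟩ := ih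
      have hgm := isSubcausal_effect_iff.1 (hg m)
      have hdg := (hg m).discard_sub
      have hdgK := (isSubcausal_effect_iff.1 hdg).1
      have hne : ∀ k ∈ P, k ≠ m := fun k hk h => hm (h ▸ hk)
      -- Clone, and test for `m` on the second copy; only if that fails is the old measurement
      -- applied to the first copy.
      refine ⟨fun k => if k = m then χ ≫ tensorEffect (T.discard A) (g m) else
        χ ≫ tensorEffect (F k) (T.discard A - g m), fun k => ?_, ?_, ?_⟩
      · dsimp only
        split_ifs
        · exact T.comp_mem _ _ hχ.1 (T.tensorEffect_mem (T.discard_mem A) hgm.1)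
        · exact T.comp_mem _ _ hχ.1 (T.tensorEffect_mem (hFK k) hdgK)
      · rw [Finset.sum_insert hm, if_pos rfl, Finset.sum_congr rfl fun k hk => if_neg (hne k hk)]
        have hsum : ∑ k ∈ P, χ ≫ tensorEffect (F k) (T.discard A - g m) =
            χ ≫ tensorEffect (∑ k ∈ P, F k) (T.discard A - g m) := by
          simp only [tensorEffect, sum_tensor, Preadditive.sum_comp, Preadditive.comp_sum]
        rw [hsum]
        have h1 := T.le_iff.1 hχ.2
        have h2 := T.comp_mem _ _ hχ.1 (T.tensorEffect_mem hFsum hdgK)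
        have h3 := add_mem h1 h2
        convert h3 using 1
        rw [T.discard_tensor', tensorEffect_sub_left,
          tensorEffect_sub_right (T.discard A) (T.discard A), Preadditive.comp_sub,
          Preadditive.comp_sub]
        abel
      · intro k hk j
        by_cases hkm : k = m
        · simp only [hkm, if_true]
          rw [hclone j _ _ (hg m), (ht j).num_discard, one_mul, hgt]
        · have hkP : k ∈ P := (Finset.mem_insert.1 hk).resolve_left hkm
          simp only [if_neg hkm]
          rw [hclone j _ _ hdg, hF k hkP, Preadditive.comp_sub, map_sub, (ht j).num_discard, hgt]
          by_cases hjk : j = k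
          · have : j ≠ m := fun h => hkm (hjk ▸ h)
            simp [hjk, hkm]
          · simp [hjk]
  obtain ⟨F, hFK, hFsum, hF⟩ := main Finset.univ
  -- The leftover effect vanishes on every `t j`, so it can be added to any one outcome to complete
  -- the measurement.
  refine ⟨fun k => F k + if k = 0 then T.discard A - ∑ k, F k else 0, fun k => ?_, ?_, ?_⟩
  · dsimp only
    split_ifs
    · exact add_mem (hFK k) hFsum
    · exact add_mem (hFK k) (zero_mem _)
  · simp [Finset.sum_add_distrib]
  · intro j k
    have h0 : T.num (t j ≫ (T.discard A - ∑ k, F k)) = 0 := by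
      rw [Preadditive.comp_sub, map_sub, (ht j).num_discard, Preadditive.comp_sum, map_sum]
      simp [hF]
    rw [Preadditive.comp_add, map_add, hF k (Finset.mem_univ k)]
    by_cases hk : k = 0
    · rw [if_pos hk, h0, add_zero]
    · simp [hk]

namespace BankStrategy

variable {S : T.BankStrategy A}

lemma e_isSubcausal (i : S.ι) : T.IsSubcausal (S.e i) :=
  isSubcausal_effect_iff.2 ⟨S.e_mem i, S.e_le i⟩

lemma num_verify_eq_one {χ : A ⟶ A ⊗ A} (hχ : T.IsSubcausal χ) (h : S.successProb χ = 1)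
    (i : S.ι) : T.num (S.s i ≫ χ ≫ tensorEffect (S.e i) (S.e i)) = 1 := by
  have hnn : ∀ j ∈ Finset.univ,
      0 ≤ S.p j * (1 - T.num (S.s j ≫ χ ≫ tensorEffect (S.e j) (S.e j))) :=
    fun j _ => mul_nonneg (S.p_pos j).le (sub_nonneg.2 (S.num_verify_le_one hχ j))
  have hsum : ∑ j, S.p j * (1 - T.num (S.s j ≫ χ ≫ tensorEffect (S.e j) (S.e j))) = 0 := by
    simp only [mul_sub, mul_one, Finset.sum_sub_distrib, S.p_sum]
    rw [successProb] at h
    rw [h, sub_self]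
  have := (Finset.sum_eq_zero_iff_of_nonneg hnn).1 hsum i (Finset.mem_univ i)
  rcases mul_eq_zero.1 this with h | h
  · exact absurd h (S.p_pos i).ne'
  · linarith

/-- A sharp strategy that can be counterfeited perfectly has a classical ensemble. -/
lemma VerificationSharp.classicalEnsemble (hS : S.VerificationSharp) (h : 1 ≤ S.alpha) :
    S.ClassicalEnsemble := by
  obtain ⟨χ, hχ, hχα⟩ := S.exists_successProb_eq_alpha
  have h1 : S.successProb χ = 1 := le_antisymm (S.successProb_le_one hχ) (hχα ▸ h)
  have hclone : ∀ i, T.Clones χ (S.s i) := fun i =>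
    clones_of_sharp hχ (S.s_causal i) (e_isSubcausal i) (fun t ht h => (hS i t ht).1 h)
      (num_verify_eq_one hχ h1 i)
  have hne : Nonempty S.ι := by
    by_contra hempty
    rw [not_nonempty_iff] at hempty
    simpa using S.p_sum
  -- Different indices may carry the same state, so the distinct states are enumerated.
  let ε := Finite.equivFin (Set.range S.s)
  have : NeZero (Nat.card (Set.range S.s)) := ⟨Nat.card_pos.ne'⟩
  choose idx hidx using fun k => (ε.symm k).2
  have hinj : Function.Injective fun k => S.s (idx k) := fun k l hkl => by
    simp only [hidx] at hkl
    exact ε.symm.injective (Subtype.ext hkl)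
  choose g hg hg1 hg0 using fun k => exists_separating_effect hχ (fun k => S.s (idx k))
    (fun k => S.s_causal _) (fun k => hclone _) k (e_isSubcausal (idx k)) (S.accept _)
    (fun j hj h => hj (hinj ((hS _ _ (isSubcausal_state_iff.2
      ⟨(S.s_causal _).1, (S.s_causal _).num_discard.le⟩)).1 h)))
  obtain ⟨f, hfK, hfsum, hf⟩ := exists_measurement hχ (fun k => S.s (idx k))
    (fun k => S.s_causal _) (fun k => hclone _) g hg (fun j k => by
      split_ifs with hjk
      · rw [hjk]
        exact hg1 k
      · exact hg0 k j hjk)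
  refine ⟨_, fun k => S.s (idx k), f, fun k => S.s_causal _, hfK, hfsum, hf, fun i => ?_⟩
  refine subset_convexHull ℝ _ ⟨ε ⟨S.s i, i, rfl⟩, ?_⟩
  simp only [hidx, Equiv.symm_apply_apply]

lemma VerificationSharp.alpha_lt_one (hS : S.VerificationSharp) (h : ¬ S.ClassicalEnsemble) :
    S.alpha < 1 :=
  not_le.1 fun h1 => h (hS.classicalEnsemble h1)

end BankStrategy

end GPT

/-! ### Exposed states and non-classical systems -/

namespace GPT

variable {C : Type u} [Category.{v} C] [Preadditive C] [Linear ℝ C] [MonoidalCategory C]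
  [MonoidalPreadditive C] [MonoidalLinear ℝ C] [SymmetricCategory C] {T : GPT C} {A : C}

lemma mem_causalStates_iff {s : 𝟙_ C ⟶ A} :
    s ∈ T.causalStates A ↔ s ∈ T.cone (𝟙_ C) A ∧ T.num (s ≫ T.discard A) = 1 :=
  ⟨fun h => ⟨h.1, h.num_discard⟩, fun h => ⟨h.1, by
    rw [T.discard_unit]
    exact T.num.injective (by rw [h.2, T.num_id])⟩⟩

lemma convex_causalStates (A : C) : Convex ℝ (T.causalStates A) := by
  intro s hs t ht a b ha hb hab
  rw [mem_causalStates_iff] at hs ht ⊢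
  refine ⟨add_mem (PointedCone.smul_mem _ ha hs.1) (PointedCone.smul_mem _ hb ht.1), ?_⟩
  simp [hs.2, ht.2, hab]

lemma isCompact_causalStates (A : C) :
    @IsCompact _ (moduleTopology ℝ (𝟙_ C ⟶ A)) (T.causalStates A) := by
  have h := IsCompact.inter_linearMap_eq (T.isCompact_subcausal (𝟙_ C) A)
    ((T.pairing A).flip (T.discard A)) 1
  convert h using 1
  ext s
  rw [mem_causalStates_iff, Set.mem_inter_iff, Set.mem_ofPred_eq, isSubcausal_state_iff]
  change _ ↔ _ ∧ T.num (s ≫ T.discard A) = 1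
  exact ⟨fun h => ⟨⟨h.1, h.2.le⟩, h.2⟩, fun h => ⟨h.1.1, h.2⟩⟩

/-- The exposed points of the convex set of causal states. -/
def exposedStates (T : GPT C) (A : C) : Set (𝟙_ C ⟶ A) :=
  {s | s ∈ T.causalStates A ∧
    ∃ φ : (𝟙_ C ⟶ A) →ₗ[ℝ] ℝ, ∀ t ∈ T.causalStates A, t ≠ s → φ t < φ s}

/-- Under the No-Restriction Hypothesis exposed states have sharp verifications. -/
lemma NoRestriction.exists_sharp_effect (hNR : T.NoRestriction) {s : 𝟙_ C ⟶ A}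
    (hs : s ∈ T.exposedStates A) :
    ∃ e : A ⟶ 𝟙_ C, T.IsSubcausal e ∧ T.num (s ≫ e) = 1 ∧
      ∀ t : 𝟙_ C ⟶ A, T.IsSubcausal t → T.num (t ≫ e) = 1 → t = s := by
  obtain ⟨hsc, φ, hφ⟩ := hs
  -- Among causal states this effect vanishes only at `s`, where `φ` is maximal. Scaled below
  -- discarding, its complement is the sharp verification.
  obtain ⟨e, heK, he⟩ := hNR A (φ s • (T.pairing A).flip (T.discard A) - φ) (by
    intro t ht
    simp only [LinearMap.sub_apply, LinearMap.smul_apply, LinearMap.flip_apply, pairing_apply,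
      smul_eq_mul]
    rcases (num_nonneg ht (T.discard_mem A)).eq_or_lt with h0 | h0
    · have : t = 0 := T.eq_zero_of_neg_discard_mem ht (by
        rw [T.mem_cone_unit, map_neg, ← h0, neg_zero])
      simp [this]
    · set c := T.num (t ≫ T.discard A)
      have htc : c⁻¹ • t ∈ T.causalStates A := by
        refine mem_causalStates_iff.2 ⟨PointedCone.smul_mem _ (inv_nonneg.2 h0.le) ht, ?_⟩
        rw [Linear.smul_comp, map_smul, smul_eq_mul, inv_mul_cancel₀ h0.ne']
      have hle : φ (c⁻¹ • t) ≤ φ s := by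
        by_cases hts : c⁻¹ • t = s
        · rw [hts]
        · exact (hφ _ htc hts).le
      rw [map_smul, smul_eq_mul, inv_mul_le_iff₀ h0] at hle
      linarith)
  simp only [LinearMap.sub_apply, LinearMap.smul_apply, LinearMap.flip_apply, pairing_apply,
    smul_eq_mul] at he
  obtain ⟨r, hr, hre⟩ := T.exists_smul_discard_sub_mem heK
  refine ⟨T.discard A - r • e, isSubcausal_effect_iff.2 ⟨hre, T.le_iff.2 ?_⟩, ?_, fun t ht h => ?_⟩
  · rw [sub_sub_cancel]
    exact PointedCone.smul_mem _ hr.le heK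
  · rw [Preadditive.comp_sub, map_sub, Linear.comp_smul, map_smul, he,
      (mem_causalStates_iff.1 hsc).2]
    simp
  · obtain ⟨htK, ht1⟩ := isSubcausal_state_iff.1 ht
    rw [Preadditive.comp_sub, map_sub, Linear.comp_smul, map_smul, smul_eq_mul] at h
    have h0 : 0 ≤ r * T.num (t ≫ e) := mul_nonneg hr.le (num_nonneg htK heK)
    have h1 : T.num (t ≫ T.discard A) = 1 := by linarith
    have h2 : r * T.num (t ≫ e) = 0 := by linarith
    have h3 := (mul_eq_zero.1 h2).resolve_left hr.ne'
    rw [he, h1, mul_one] at h3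
    by_contra hts
    have := hφ t (mem_causalStates_iff.2 ⟨htK, h1⟩) hts
    linarith

lemma linearIndependent_of_distinguishable {n : ℕ} {t : Fin n → (𝟙_ C ⟶ A)}
    {f : Fin n → (A ⟶ 𝟙_ C)} (h : ∀ j k, T.num (t j ≫ f k) = if j = k then 1 else 0) :
    LinearIndependent ℝ t := by
  rw [Fintype.linearIndependent_iff]
  intro c hc k
  have := congrArg ((T.pairing A).flip (f k)) hc
  simpa [h] using this

/-- The members of a classical ensemble of distinct exposed states are linearly independent. -/
lemma BankStrategy.ClassicalEnsemble.linearIndependent {S : T.BankStrategy A}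
    (hS : S.ClassicalEnsemble) (hexp : ∀ i, S.s i ∈ T.exposedStates A)
    (hinj : Function.Injective S.s) : LinearIndependent ℝ S.s := by
  obtain ⟨n, t, f, ht, -, -, hf, hconv⟩ := hS
  -- An exposed state is no proper mixture: if it differed from all vertices, `φ` would be strictly
  -- smaller on their whole hull.
  have hmem : ∀ i, ∃ k, t k = S.s i := by
    intro i
    obtain ⟨-, φ, hφ⟩ := hexp i
    by_contra! hne
    have hsub : convexHull ℝ (Set.range t) ⊆ {x | φ x < φ (S.s i)} := by
      refine convexHull_min ?_ (convex_halfSpace_lt φ.isLinear _)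
      rintro _ ⟨k, rfl⟩
      exact hφ _ (ht k) (hne k)
    exact lt_irrefl (φ (S.s i)) (hsub (hconv i))
  choose κ hκ using hmem
  have hκinj : Function.Injective κ := fun i j hij => hinj (by rw [← hκ, ← hκ, hij])
  have := (linearIndependent_of_distinguishable hf).comp κ hκinj
  rwa [show t ∘ κ = S.s from funext hκ] at this

/-- The strategy that samples uniformly from given states. -/
noncomputable def uniformStrategy {n : ℕ} [NeZero n] (s : Fin n → (𝟙_ C ⟶ A))
    (e : Fin n → (A ⟶ 𝟙_ C)) (hs : ∀ i, T.IsCausal (s i)) (he : ∀ i, T.IsSubcausal (e i))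
    (hse : ∀ i, T.num (s i ≫ e i) = 1) : T.BankStrategy A where
  ι := Fin n
  p := fun _ => (n : ℝ)⁻¹
  s := s
  e := e
  p_pos := fun _ => inv_pos.2 (Nat.cast_pos.2 (NeZero.pos n))
  p_sum := by simp
  s_causal := hs
  e_mem := fun i => (isSubcausal_effect_iff.1 (he i)).1
  e_le := fun i => (isSubcausal_effect_iff.1 (he i)).2
  accept := hse

/-- A system that is not classical carries a sharp strategy without classical ensemble. -/
lemma NoRestriction.exists_sharp_not_classicalEnsemble (hNR : T.NoRestriction)
    (hA : ¬ T.IsClassicalSystem A) :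
    ∃ S : T.BankStrategy A, S.VerificationSharp ∧ ¬ S.ClassicalEnsemble := by
  by_contra! hcl
  have := T.finite (𝟙_ C) A
  -- A finite nonempty family of distinct exposed states is the ensemble of a sharp uniform
  -- strategy, which is classical by the assumption `hcl`.
  have hfam : ∀ (n : ℕ) (s : Fin n → (𝟙_ C ⟶ A)), (∀ i, s i ∈ T.exposedStates A) →
      Function.Injective s → LinearIndependent ℝ s := by
    intro n s hs hinj
    rcases Nat.eq_zero_or_pos n with rfl | hn
    · exact linearIndependent_empty_type
    have : NeZero n := ⟨hn.ne'⟩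
    choose e he hse hsharp using fun i => hNR.exists_sharp_effect (hs i)
    let S : T.BankStrategy A := uniformStrategy s e (fun i => (hs i).1) he hse
    have hS : S.VerificationSharp := fun i t ht =>
      ⟨hsharp i t ht, fun h => h ▸ hse i⟩
    exact (hcl S hS).linearIndependent hs hinj
  have hli : LinearIndependent ℝ (Subtype.val : T.exposedStates A → (𝟙_ C ⟶ A)) := by
    rw [linearIndependent_iff_finset_linearIndependent]
    intro P
    rw [← linearIndependent_equiv P.equivFin.symm]
    exact hfam _ _ (fun i => (P.equivFin.symm i).1.2)
      ((Subtype.val_injective.comp Subtype.val_injective).comp P.equivFin.symm.injective)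
  have : Finite (T.exposedStates A) := hli.finite
  let ε := Finite.equivFin (T.exposedStates A)
  refine hA ⟨_, fun k => (ε.symm k).1, (hli.comp _ ε.symm.injective).affineIndependent, ?_⟩
  have hrange : Set.range (fun k => (ε.symm k).1) = T.exposedStates A := by
    rw [← Function.comp_def, ε.symm.surjective.range_comp, Subtype.range_coe]
  rw [hrange]
  refine Set.Subset.antisymm ?_ (convexHull_min (fun s hs => hs.1) (convex_causalStates A))
  exact (isCompact_causalStates A).subset_convexHull_of_exposed (Set.toFinite _)
    fun y hy h => ⟨hy, h⟩

/-- Repetitions of a strategy with counterfeiting value less than one give unforgeable money. -/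
lemma BankStrategy.snc_of_alpha_lt_one (hNR : T.NoRestriction) (S : T.BankStrategy A)
    (hS : S.alpha < 1) : T.SNC := by
  intro δ hδ
  obtain ⟨n, hn⟩ := exists_pow_lt_of_lt_one hδ hS
  refine ⟨_, S.copies n, (S.alpha_copies_le hNR n).trans ?_⟩
  -- The extra copy in `copies n` only lowers the bound.
  exact (pow_le_pow_of_le_one S.alpha_nonneg hS.le n.le_succ).trans hn.le

end GPT

theorem mainTheorem6 {C : Type u} [Category.{v} C] [Preadditive C] [Linear ℝ C]
    [MonoidalCategory C] [MonoidalPreadditive C] [MonoidalLinear ℝ C] [SymmetricCategory C]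
    (T : GPT C) (hT : T.NonClassical) (hNR : T.NoRestriction) (hTL : T.TomographicLocality)
    {A : C} (S : T.BankStrategy A) (hS : S.VerificationSharp) :
    T.SNC ∧
      (¬ S.ClassicalEnsemble →
        S.alpha < 1 ∧ ∀ n : ℕ, (S.copies n).alpha ≤ S.alpha ^ (n + 1)) := by
  obtain ⟨B, hB⟩ := hT
  obtain ⟨S', hS', hcl⟩ := hNR.exists_sharp_not_classicalEnsemble hB
  exact ⟨S'.snc_of_alpha_lt_one hNR (hS'.alpha_lt_one hcl),
    fun h => ⟨hS.alpha_lt_one h, S.alpha_copies_le hNR⟩⟩
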